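/- **Model.** Pico base stations (BSs) form a homogeneous Poisson point process $\Phi_2$ of density $\lambda_2>0$ in $\mathbb R^2$, and the typical user is at the origin. The BSs carry independent marks: each $x\in\Phi_2$ stores the $f$-th file with probability $p_{2,f}\in(0,1]$, has a fading power $|h_x|^2\sim\mathrm{Gamma}$ with shape $N_2^p$ and mean $1$ ($N_2^p\ge 1$ an integer), and has an angle $\omega_x$ uniform on $[-\tfrac d\lambda,\tfrac d\lambda]$ ($d,\lambda>0$). The marks are mutually independent and independent of $\Phi_2$. The array gain is $G_2(\omega)=\frac{\sin^2(\pi N_2\omega)}{N_2^2\sin^2(\pi\omega)}$ with $N_2\ge1$ an integer (and $G_2(\omega)=1$, by continuity, for $\omega\in\mathbb Z$). The path loss is $L_2(v)=C_2v^{-\alpha_2}$ for $v\le R_L$ and $L_2(v)=0$ for $v>R_L$, with $C_2,R_L>0$, and the transmit power is $P_2>0$. Let $x_0$ be the BS nearest to the origin among those storing the $f$-th file, and let $$I=\sum_{x\in\Phi_2\setminus\{x_0\}}P_2L_2(\|x\|)\,N_2|h_x|^2G_2(\omega_x)$$ be the pico-tier interference. For $s,\tau\ge0$ and $0<r\le R_L$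 write $$\mathcal L_2(s,\tau)=\mathbb E\Big[\exp\Big(-\tfrac{s\tau}{P_2C_2N_2}\,I\Big)\,\Big|\,\|x_0\|=r\Big]$$ for its Laplace transform, taken with respect to a regular conditional distribution of $I$ given $\|x_0\|$. **Lemma 1.** For almost every $r\in(0,R_L]$ and all $s,\tau\ge 0$, $$\mathcal L_2(s,\tau)=\lim_{u_1\to\infty}\exp\Big(-\pi\lambda_2(R_L^2-p_{2,f}r^2)-\frac{\pi^2\lambda_2}{2u_1}\sum_{k_1=1}^{u_1}W_f\big(\tfrac{x_{k_1}d}{\lambda},s,\tau\big)\sqrt{1-x_{k_1}^2}\Big),\qquad x_{k_1}=\cos\Big(\frac{2k_1-1}{2u_1}\pi\Big),$$ where $W_f$ is given as follows, with $X=\frac{sG_2(\omega)\tau}{N_2^p}$. 1. If $\alpha_2>2$, then $$W_f(\omega,s,\tau)=p_{2,f}\,S_2^0\big(X r^{-\alpha_2}\big)r^2+(1-p_{2,f})\,\Delta_2(X)-S_2^0\big(XR_L^{-\alpha_2}\big)R_L^2 ,$$ where $S_2^0(z)={}_2F_1\big(-\tfrac2{\alpha_2},N_2^p;1-\tfrac2{\alpha_2};-z\big)$,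 with ${}_2F_1$ the (analytically continued) Gauss hypergeometric function, and $\Delta_2(z)=\Gamma\big(1-\tfrac2{\alpha_2}\big)\Gamma\big(N_2^p+\tfrac2{\alpha_2}\big)\Gamma(N_2^p)^{-1}z^{2/\alpha_2}$. 2. If $\alpha_2=2$, then $$W_f(\omega,s,\tau)=X\Big(F_y\big(X/R_L^2\big)-p_{2,f}F_y\big(X/r^2\big)\Big)$$ (to be read as its limit $p_{2,f}r^2-R_L^2$ where $X=0$), where $$F_y(y)=N_2^p\ln\Big(1+\frac1y\Big)-\frac1{y(1+y)^{N_2^p-1}}-\sum_{m=1}^{N_2^p-1}\frac{N_2^p}{(1+y)^{N_2^p-m}(N_2^p-m)} .$$ -/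

import Mathlib

open MeasureTheory ProbabilityTheory Filter Topology

noncomputable section

namespace HetNet

/-- The plane in which the base stations (BSs) are placed; the typical user is at the origin. -/
abbrev Plane : Type := EuclideanSpace ℝ (Fin 2)

/-- Deterministic parameters of the pico tier, for a catalogue of `Nc` files. -/
structure Params (Nc : ℕ) where
  /-- density of the pico BSs -/
  lam : ℝ
  /-- radius of the line-of-sight ball -/
  RL : ℝ
  /-- path loss exponent -/
  α : ℝ
  /-- path loss intercept -/
  C : ℝ
  /-- transmit power -/
  P : ℝ
  /-- number of antenna elements of a pico BS -/
  Nant : ℕ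
  /-- Nakagami fading parameter -/
  Nnak : ℕ
  /-- antenna spacing -/
  d : ℝ
  /-- wavelength -/
  wl : ℝ
  /-- `p f` is the probability that a pico BS stores the file `f` -/
  p : Fin Nc → ℝ
  lam_pos : 0 < lam
  RL_pos : 0 < RL
  C_pos : 0 < C
  P_pos : 0 < P
  Nant_pos : 0 < Nant
  Nnak_pos : 0 < Nnak
  d_pos : 0 < d
  wl_pos : 0 < wl
  p_nonneg : ∀ f, 0 ≤ p f
  p_le_one : ∀ f, p f ≤ 1

/-- The random objects of the pico tier: an enumeration of the points of the process of BS
locations and, for the `n`-th BS, the set of files it stores, the fading power `|h|²` on its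
link to the typical user, and the spatial angle entering its array gain. -/
structure PicoTier (Ω : Type*) (Nc : ℕ) where
  loc : ℕ → Ω → Plane
  cache : ℕ → Ω → Set (Fin Nc)
  fading : ℕ → Ω → ℝ
  angle : ℕ → Ω → ℝ

/-- `X 0, X 1, …` enumerates the points of a homogeneous Poisson point process of density `lam`
on the plane: the number of points in a bounded Borel set `A` is Poisson with mean
`lam * volume A`, and the numbers of points in disjoint bounded Borel sets are independent. -/
structure IsHPPP {Ω : Type*} [MeasurableSpace Ω] (μ : Measure Ω) (lam : ℝ)
    (X : ℕ → Ω → Plane) : Prop where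
  measurable : ∀ n, Measurable (X n)
  poisson : ∀ A : Set Plane, MeasurableSet A → Bornology.IsBounded A → ∀ k : ℕ,
    μ {ω | {n | X n ω ∈ A}.encard = k} =
      poissonMeasure (lam * (volume A).toReal).toNNReal {k}
  indep : ∀ (m : ℕ) (A : Fin m → Set Plane), (∀ i, MeasurableSet (A i)) →
    (∀ i, Bornology.IsBounded (A i)) → Pairwise (fun i j => Disjoint (A i) (A j)) →
    iIndepFun (fun i ω => {n | X n ω ∈ A i}.encard) μ

/-- The independent sources of randomness: the whole point process, and the marks of each BS. -/
inductive Source : Type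
  | locations : Source
  | cache (n : ℕ) : Source
  | fading (n : ℕ) : Source
  | angle (n : ℕ) : Source

/-- The σ-algebra generated by a source of randomness. -/
@[reducible] def PicoTier.sigma {Ω : Type*} {Nc : ℕ} (T : PicoTier Ω Nc) : Source → MeasurableSpace Ω
  | .locations => ⨆ n, MeasurableSpace.comap (T.loc n) inferInstance
  | .cache n => MeasurableSpace.comap (T.cache n) inferInstance
  | .fading n => MeasurableSpace.comap (T.fading n) inferInstance
  | .angle n => MeasurableSpace.comap (T.angle n) inferInstance

/-- The probabilistic model: BSs form a homogeneous Poisson point process, and are independently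
marked with their cache content, a normalized Gamma fading power and a uniform angle. -/
structure IsPicoTier {Ω : Type*} [MeasurableSpace Ω] (μ : Measure Ω) {Nc : ℕ} (Q : Params Nc)
    (T : PicoTier Ω Nc) : Prop where
  hppp : IsHPPP μ Q.lam T.loc
  cache_measurable : ∀ n, Measurable (T.cache n)
  fading_measurable : ∀ n, Measurable (T.fading n)
  angle_measurable : ∀ n, Measurable (T.angle n)
  cache_law : ∀ n f, μ {ω | f ∈ T.cache n ω} = ENNReal.ofReal (Q.p f)
  fading_law : ∀ n, μ.map (T.fading n) = gammaMeasure (Q.Nnak : ℝ) (Q.Nnak : ℝ)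
  angle_law : ∀ n, pdf.IsUniform (T.angle n) (Set.Icc (-(Q.d / Q.wl)) (Q.d / Q.wl)) μ volume
  indep : iIndep T.sigma μ

/-- Array gain of a uniform linear array with `N` elements,
`sin² (π N w) / (N² sin² (π w))`, with the limit value `1` where the denominator vanishes. -/
def arrayGain (N : ℕ) (w : ℝ) : ℝ :=
  if Real.sin (Real.pi * w) = 0 then 1
  else Real.sin (Real.pi * N * w) ^ 2 / ((N : ℝ) ^ 2 * Real.sin (Real.pi * w) ^ 2)

/-- Path loss law `U(R_L - v) C v^(-α)` of the line-of-sight ball model. -/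
def pathLoss {Nc : ℕ} (Q : Params Nc) (v : ℝ) : ℝ :=
  if 0 ≤ Q.RL - v then Q.C * v ^ (-Q.α) else 0

/-- The `n`-th BS is the serving one: it is nearest to the user among those storing `f`. -/
def PicoTier.IsServing {Ω : Type*} {Nc : ℕ} (T : PicoTier Ω Nc) (f : Fin Nc) (n : ℕ)
    (ω : Ω) : Prop :=
  f ∈ T.cache n ω ∧ ∀ m, f ∈ T.cache m ω → ‖T.loc n ω‖ ≤ ‖T.loc m ω‖

/-- Distance from the typical user to the nearest BS storing the file `f`. -/
def PicoTier.servingDist {Ω : Type*} {Nc : ℕ} (T : PicoTier Ω Nc) (f : Fin Nc) (ω : Ω) : ℝ :=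
  sInf {v | ∃ n, f ∈ T.cache n ω ∧ v = ‖T.loc n ω‖}

open Classical in
/-- Interference at the typical user: the power received from all pico BSs (whether or not they
store `f`) other than the serving one. -/
def PicoTier.interference {Ω : Type*} {Nc : ℕ} (T : PicoTier Ω Nc) (Q : Params Nc)
    (f : Fin Nc) (ω : Ω) : ℝ :=
  ∑' n, if T.IsServing f n ω then 0
    else Q.P * pathLoss Q ‖T.loc n ω‖ *
      (Q.Nant * T.fading n ω * arrayGain Q.Nant (T.angle n ω))

/-- Laplace transform `E[exp(-s τ I / (P C N)) | ‖x₀‖ = r]` of the interference `I` (normalized by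
transmit power, intercept and array size), given that the serving BS is at distance `r`. -/
def laplaceInterference {Ω : Type*} [MeasurableSpace Ω] (μ : Measure Ω) [IsProbabilityMeasure μ]
    {Nc : ℕ} (Q : Params Nc) (T : PicoTier Ω Nc) (f : Fin Nc) (r s τ : ℝ) : ℝ :=
  ∫ y, Real.exp (-(s * τ / (Q.P * Q.C * Q.Nant)) * y)
    ∂(condDistrib (T.interference Q f) (T.servingDist f) μ r)

open Classical in
/-- Gauss hypergeometric function on the half-line `(-∞, 1)`: the analytic continuation of the
hypergeometric series (it is unique, the half-line being connected). -/
def gaussHyp (a b c : ℝ) : ℝ → ℝ :=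
  if h : ∃ F : ℝ → ℝ, AnalyticOnNhd ℝ F (Set.Iio 1) ∧
      ∀ x ∈ Set.Ioo (-1 : ℝ) 1, F x = ordinaryHypergeometric a b c x
  then h.choose else 0

/-- `S^k(z) = ₂F₁(k - 2/α, k + N; k + 1 - 2/α; -z)`. -/
def hypS (α : ℝ) (N k : ℕ) (z : ℝ) : ℝ :=
  gaussHyp (k - 2 / α) (k + N) (k + 1 - 2 / α) (-z)

/-- `Δ(z) = Γ(1 - 2/α) Γ(N + 2/α) Γ(N)⁻¹ z^(2/α)`. -/
def gammaDelta (α : ℝ) (N : ℕ) (z : ℝ) : ℝ :=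
  Real.Gamma (1 - 2 / α) * Real.Gamma (N + 2 / α) * (Real.Gamma N)⁻¹ * z ^ (2 / α)

/-- The argument `s G(w) τ / N^p`. -/
def argX {Nc : ℕ} (Q : Params Nc) (w s τ : ℝ) : ℝ :=
  s * arrayGain Q.Nant w * τ / Q.Nnak

/-- `W_f(w, s, τ)` in the case `α > 2`. -/
def Wgt {Nc : ℕ} (Q : Params Nc) (f : Fin Nc) (r w s τ : ℝ) : ℝ :=
  Q.p f * hypS Q.α Q.Nnak 0 (argX Q w s τ / r ^ Q.α) * r ^ 2
    + (1 - Q.p f) * gammaDelta Q.α Q.Nnak (argX Q w s τ)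
    - hypS Q.α Q.Nnak 0 (argX Q w s τ / Q.RL ^ Q.α) * Q.RL ^ 2

/-- `F_y(y)` for the fading parameter `N`. -/
def Fy (N : ℕ) (y : ℝ) : ℝ :=
  N * Real.log (1 + 1 / y) - 1 / (y * (1 + y) ^ (N - 1))
    - ∑ m ∈ Finset.Icc 1 (N - 1), (N : ℝ) / ((1 + y) ^ (N - m) * ((N : ℝ) - m))

/-- `W_f(w, s, τ)` in the case `α = 2`. Where `s G(w) τ = 0`, so that the expression reads
`0 · ∞`, it has its limit value `p r² - R_L²`. -/
def Weq {Nc : ℕ} (Q : Params Nc) (f : Fin Nc) (r w s τ : ℝ) : ℝ :=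
  if argX Q w s τ = 0 then Q.p f * r ^ 2 - Q.RL ^ 2
  else argX Q w s τ *
    (Fy Q.Nnak (argX Q w s τ / Q.RL ^ 2) - Q.p f * Fy Q.Nnak (argX Q w s τ / r ^ 2))

/-- Gauss–Chebyshev node `cos ((2k - 1) π / (2u))`. -/
def chebNode (u k : ℕ) : ℝ := Real.cos ((2 * k - 1) / (2 * u) * Real.pi)

/-- The closed form with `u` quadrature nodes, for a given function `W` of the angle. -/
def closedForm {Nc : ℕ} (Q : Params Nc) (f : Fin Nc) (r : ℝ) (W : ℝ → ℝ) (u : ℕ) : ℝ :=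
  Real.exp (-(Real.pi * Q.lam * (Q.RL ^ 2 - Q.p f * r ^ 2))
    - Real.pi ^ 2 * Q.lam / (2 * u) *
      ∑ k ∈ Finset.Icc 1 u, W (chebNode u k * Q.d / Q.wl) * Real.sqrt (1 - chebNode u k ^ 2))

end HetNet

end

/-!
The interferers are the BSs that do not store `f` or lie beyond the serving BS, so conditioning on
`‖x₀‖ = r` should turn `I` into the power `U_r` received from a thinned Poisson process independent
of `x₀`. Palm theory is avoided as follows. On the event that the serving BS lies in a thin annulus
`a < ‖x‖ ≤ b`, the interference equals `U_b` unless a second BS lies in the annulus, which has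
probability of order `(b - a) ^ 2`. The event that no BS within `a` stores `f` and the variable
`exp (-κ U_b)` together form a product over the BSs, whose expectation is the exponential of the
intensity integral of one minus the mean factor. Hence `exp (-κ I)` and the candidate
`exp (-λ ∫ ...)`, evaluated at `‖x₀‖`, have the same integral over `a < ‖x₀‖ ≤ b` up to
`O((b - a) ^ 2)`, and summing over finer and finer partitions makes them agree on all intervals.

In polar coordinates the exponent is an average over the angle of radial integrals
`∫₀ᵛ 2 t (1 + X t ^ (-α)) ^ (-N) dt`. Under `z = X t ^ (-α)` these have explicit primitives:
Euler integrals, i.e. hypergeometric functions, for `α > 2`, and logarithms for `α = 2`. The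
Gauss–Chebyshev sums are Riemann sums of the remaining angular integral after `y = cos θ`.
-/

noncomputable section

namespace HetNet

section Quadrature

lemma norm_smul_sub_intervalIntegral_le {E : Type*} [NormedAddCommGroup E] [NormedSpace ℝ E]
    [CompleteSpace E] {h : ℝ → E} {a b ε : ℝ} {c : E} (hab : a ≤ b)
    (hint : IntervalIntegrable h volume a b) (hosc : ∀ x ∈ Set.Ioc a b, ‖c - h x‖ ≤ ε) :
    ‖(b - a) • c - ∫ x in a..b, h x‖ ≤ ε * (b - a) := by
  rw [← intervalIntegral.integral_const, ← intervalIntegral.integral_sub (by simp) hint]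
  refine (intervalIntegral.norm_integral_le_of_norm_le_const (C := ε) ?_).trans_eq
    (by rw [abs_of_nonneg (sub_nonneg.2 hab)])
  rwa [Set.uIoc_of_le hab]

lemma norm_uniform_riemannSum_sub_integral_le {E : Type*} [NormedAddCommGroup E] [NormedSpace ℝ E]
    [CompleteSpace E] {h : ℝ → E} {a b ε : ℝ} (hab : a ≤ b) (hc : ContinuousOn h (Set.Icc a b))
    {u : ℕ} (hu : 0 < u) {ξ : ℕ → ℝ}
    (hξ : ∀ k < u, ξ k ∈ Set.Icc (a + k * ((b - a) / u)) (a + (k + 1 : ℕ) * ((b - a) / u)))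
    (hosc : ∀ x ∈ Set.Icc a b, ∀ y ∈ Set.Icc a b, dist x y ≤ (b - a) / u → dist (h x) (h y) ≤ ε) :
    ‖((b - a) / u) • ∑ k ∈ Finset.range u, h (ξ k) - ∫ x in a..b, h x‖ ≤ ε * (b - a) := by
  set w := (b - a) / u
  have hw0 : 0 ≤ w := div_nonneg (by linarith) u.cast_nonneg
  have huw : u * w = b - a := mul_div_cancel₀ _ (by positivity)
  set node : ℕ → ℝ := fun k => a + k * w with hnode
  have hwidth (k : ℕ) : node (k + 1) - node k = w := by simp only [hnode]; push_cast; ring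
  have hcell {k : ℕ} (hk : k < u) : Set.Icc (node k) (node (k + 1)) ⊆ Set.Icc a b := by
    refine Set.Icc_subset_Icc (by simp only [hnode]; linarith [mul_nonneg k.cast_nonneg hw0]) ?_
    have : ((k + 1 : ℕ) : ℝ) * w ≤ u * w := by gcongr; exact hk
    simp only [hnode]
    linarith
  have hint {k : ℕ} (hk : k < u) : IntervalIntegrable h volume (node k) (node (k + 1)) :=
    (hc.mono (hcell hk)).intervalIntegrable_of_Icc (by linarith [hwidth k])
  have hsplit : ∑ k ∈ Finset.range u, ∫ x in node k..node (k + 1), h x = ∫ x in a..b, h x := by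
    rw [intervalIntegral.sum_integral_adjacent_intervals (a := node) fun k hk => hint hk]
    simp [hnode, huw]
  rw [← hsplit, Finset.smul_sum, ← Finset.sum_sub_distrib]
  calc ‖∑ k ∈ Finset.range u, (w • h (ξ k) - ∫ x in node k..node (k + 1), h x)‖
      ≤ ∑ _k ∈ Finset.range u, ε * w := by
        refine norm_sum_le_of_le _ fun k hk => ?_
        have hk := Finset.mem_range.1 hk
        rw [← hwidth k]
        refine norm_smul_sub_intervalIntegral_le (by linarith [hwidth k]) (hint hk) fun x hx => ?_
        have hx := Set.Ioc_subset_Icc_self hx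
        rw [← dist_eq_norm]
        exact hosc _ (hcell hk (hξ k hk)) _ (hcell hk hx)
          ((Real.dist_le_of_mem_Icc (hξ k hk) hx).trans_eq (hwidth k))
    _ = ε * (b - a) := by
        rw [Finset.sum_const, Finset.card_range, nsmul_eq_mul, ← huw]
        ring

lemma tendsto_uniform_riemannSum {E : Type*} [NormedAddCommGroup E] [NormedSpace ℝ E]
    [CompleteSpace E] {h : ℝ → E} {a b : ℝ} (hab : a ≤ b) (hc : ContinuousOn h (Set.Icc a b))
    {ξ : ℕ → ℕ → ℝ}
    (hξ : ∀ u k : ℕ, k < u →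
      ξ u k ∈ Set.Icc (a + k * ((b - a) / u)) (a + (k + 1 : ℕ) * ((b - a) / u))) :
    Tendsto (fun u : ℕ => ((b - a) / u) • ∑ k ∈ Finset.range u, h (ξ u k)) atTop
      (𝓝 (∫ x in a..b, h x)) := by
  rw [Metric.tendsto_nhds]
  intro ε hε
  have hL : 0 < b - a + 1 := by linarith
  obtain ⟨δ, hδ, hclose⟩ := Metric.uniformContinuousOn_iff_le.1
    (isCompact_Icc.uniformContinuousOn_of_continuous hc) (ε / (b - a + 1)) (by positivity)
  filter_upwards [(tendsto_const_div_atTop_nhds_zero_nat (b - a)).eventually_le_const hδ,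
    eventually_gt_atTop 0] with u hmesh hu
  rw [dist_eq_norm]
  calc ‖((b - a) / u) • ∑ k ∈ Finset.range u, h (ξ u k) - ∫ x in a..b, h x‖
      ≤ ε / (b - a + 1) * (b - a) :=
        norm_uniform_riemannSum_sub_integral_le hab hc hu (hξ u)
          fun x hx y hy hxy => hclose x hx y hy (hxy.trans hmesh)
    _ = ε * ((b - a) / (b - a + 1)) := by ring
    _ < ε := mul_lt_of_lt_one_right hε ((div_lt_one hL).2 (by linarith))

lemma integral_eq_integral_cos_mul_sqrt {g : ℝ → ℝ} (hg : Continuous g) :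
    ∫ x in (-1 : ℝ)..1, g x =
      ∫ θ in (0 : ℝ)..Real.pi, g (Real.cos θ) * Real.sqrt (1 - Real.cos θ ^ 2) := by
  have hsubst := intervalIntegral.integral_comp_mul_deriv (a := 0) (b := Real.pi) (g := g)
    (fun x _ => Real.hasDerivAt_cos x) (by fun_prop) hg
  rw [Real.cos_zero, Real.cos_pi] at hsubst
  rw [intervalIntegral.integral_symm, ← hsubst, ← intervalIntegral.integral_neg]
  refine intervalIntegral.integral_congr fun θ hθ => ?_
  rw [Set.uIcc_of_le Real.pi_pos.le] at hθ
  have hsqrt : Real.sqrt (1 - Real.cos θ ^ 2) = Real.sin θ := by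
    rw [← Real.sin_sq, Real.sqrt_sq (Real.sin_nonneg_of_nonneg_of_le_pi hθ.1 hθ.2)]
  simp [hsqrt]

-- The Chebyshev nodes are the cosines of the midpoints of the uniform partition of `[0, π]`.
lemma tendsto_chebNode_sum {g : ℝ → ℝ} (hg : Continuous g) :
    Tendsto (fun u : ℕ => Real.pi / u *
      ∑ k ∈ Finset.Icc 1 u, g (chebNode u k) * Real.sqrt (1 - chebNode u k ^ 2)) atTop
      (𝓝 (∫ x in (-1 : ℝ)..1, g x)) := by
  rw [integral_eq_integral_cos_mul_sqrt hg]
  have hmid := tendsto_uniform_riemannSum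
    (h := fun θ => g (Real.cos θ) * Real.sqrt (1 - Real.cos θ ^ 2)) Real.pi_pos.le
    (by fun_prop) (ξ := fun u k => (2 * (k + 1 : ℕ) - 1) / (2 * u) * Real.pi) fun u k hk => by
      have hu : (0 : ℝ) < u := by exact_mod_cast (Nat.zero_le k).trans_lt hk
      have hcell : 0 < Real.pi / u := by positivity
      rw [show (2 * ((k + 1 : ℕ) : ℝ) - 1) / (2 * u) * Real.pi = (k + 1 / 2) * (Real.pi / u) by
        push_cast; field_simp; ring]
      push_cast
      rw [sub_zero, zero_add, zero_add]
      constructor <;> nlinarith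
  refine hmid.congr fun u => ?_
  rw [Finset.range_eq_Ico, Finset.sum_Ico_add' (fun k : ℕ => g (Real.cos ((2 * k - 1) / (2 * u) *
    Real.pi)) * Real.sqrt (1 - Real.cos ((2 * k - 1) / (2 * u) * Real.pi) ^ 2)) 0 u 1, sub_zero,
    smul_eq_mul]
  rfl

end Quadrature

section ArrayGain

lemma arrayGain_eq_chebyshev_sq {N : ℕ} (hN : 0 < N) (w : ℝ) :
    arrayGain N w =
      ((Polynomial.Chebyshev.U ℝ (N - 1 : ℤ)).eval (Real.cos (Real.pi * w)) / N) ^ 2 := by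
  have hN' : (N : ℝ) ≠ 0 := by positivity
  have hU := Polynomial.Chebyshev.U_real_cos (Real.pi * w) (N - 1 : ℤ)
  push_cast at hU
  rw [sub_add_cancel] at hU
  unfold arrayGain
  split_ifs with hsin
  · rcases Real.sin_eq_zero_iff_cos_eq.1 hsin with hcos | hcos
    · rw [hcos, Polynomial.Chebyshev.U_eval_one]
      push_cast
      rw [sub_add_cancel, div_self hN', one_pow]
    · rw [hcos, Polynomial.Chebyshev.U_eval_neg_one]
      push_cast
      rw [sub_add_cancel, mul_div_assoc, div_self hN', mul_one]
      rcases Int.even_or_odd (N - 1 : ℤ) with hpar | hpar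
      · simp [Int.negOnePow_even _ hpar]
      · simp [Int.negOnePow_odd _ hpar]
  · rw [show Real.pi * N * w = N * (Real.pi * w) by ring, ← hU]
    field_simp

lemma continuous_arrayGain {N : ℕ} (hN : 0 < N) : Continuous (arrayGain N) := by
  rw [funext (arrayGain_eq_chebyshev_sq hN)]
  fun_prop

lemma arrayGain_nonneg (N : ℕ) (w : ℝ) : 0 ≤ arrayGain N w := by
  unfold arrayGain
  split_ifs <;> positivity

end ArrayGain

section Hypergeometric

lemma min_one_one_sub_re_le_norm_one_sub_mul {t : ℝ} (ht : t ∈ Set.Icc (0 : ℝ) 1) (z : ℂ) :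
    min 1 (1 - z.re) ≤ ‖1 - t * z‖ := by
  have hre : (1 - t * z : ℂ).re = 1 - t * z.re := by simp
  refine le_trans ?_ (hre ▸ Complex.re_le_norm (1 - t * z))
  rcases le_or_gt z.re 0 with hz | hz
  · exact (min_le_left _ _).trans (by nlinarith [ht.1])
  · exact (min_le_right _ _).trans (by nlinarith [ht.2])

lemma norm_inv_one_sub_mul_pow_le {t : ℝ} (ht : t ∈ Set.Icc (0 : ℝ) 1) {z : ℂ} {ρ : ℝ}
    (hρ : ρ < 1) (hz : z.re ≤ ρ) (n : ℕ) :
    ‖((1 - t * z) ^ n)⁻¹‖ ≤ (min 1 (1 - ρ) ^ n)⁻¹ := by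
  rw [norm_inv, norm_pow]
  exact inv_anti₀ (pow_pos (lt_min one_pos (by linarith)) n)
    (pow_le_pow_left₀ (le_min zero_le_one (by linarith)) ((min_le_min_left _ (by linarith)).trans
      (min_one_one_sub_re_le_norm_one_sub_mul ht z)) n)

lemma hasDerivAt_inv_one_sub_mul_pow {a z : ℂ} (h : 1 - a * z ≠ 0) (n : ℕ) :
    HasDerivAt (fun z : ℂ => ((1 - a * z) ^ n)⁻¹) (n * a * ((1 - a * z) ^ (n + 1))⁻¹) z := by
  have hlin : HasDerivAt (fun z : ℂ => 1 - a * z) (-a) z := by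
    simpa using ((hasDerivAt_id z).const_mul a).const_sub 1
  refine ((hlin.pow n).inv (pow_ne_zero _ h)).congr_deriv ?_
  rcases n with _ | n
  · simp
  · simp only [Nat.add_sub_cancel, Pi.pow_apply]
    field_simp
    ring

lemma differentiableAt_integral_mul_inv_one_sub_mul_pow {φ : ℝ → ℂ}
    (hφ : IntervalIntegrable φ volume 0 1) (n : ℕ) {z₀ : ℂ} (hz₀ : z₀.re < 1) :
    DifferentiableAt ℂ (fun z : ℂ => ∫ t in (0 : ℝ)..1, φ t * ((1 - t * z) ^ n)⁻¹) z₀ := by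
  obtain ⟨ρ, hz₀ρ, hρ⟩ := exists_between hz₀
  have hIcc {t : ℝ} (ht : t ∈ Set.uIoc (0 : ℝ) 1) : t ∈ Set.Icc (0 : ℝ) 1 := by
    rw [Set.uIoc_of_le zero_le_one] at ht
    exact Set.Ioc_subset_Icc_self ht
  have hφm : AEStronglyMeasurable φ (volume.restrict (Set.uIoc 0 1)) := hφ.def'.1
  refine (intervalIntegral.hasDerivAt_integral_of_dominated_loc_of_deriv_le (𝕜 := ℂ)
    (F' := fun z t => φ t * (n * t * ((1 - t * z) ^ (n + 1))⁻¹))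
    (s := {z : ℂ | z.re < ρ}) (bound := fun t => ‖φ t‖ * (n * (min 1 (1 - ρ) ^ (n + 1))⁻¹))
    ((isOpen_lt Complex.continuous_re continuous_const).mem_nhds hz₀ρ) ?_ ?_ ?_ ?_
    (hφ.norm.mul_const _) ?_).2.differentiableAt
  · exact Eventually.of_forall fun z => hφm.mul (Measurable.aestronglyMeasurable (by fun_prop))
  · rw [intervalIntegrable_iff]
    refine hφ.def'.mul_bdd (c := (min 1 (1 - ρ) ^ n)⁻¹)
      (Measurable.aestronglyMeasurable (by fun_prop)) ?_
    exact (ae_restrict_mem measurableSet_uIoc).mono fun t ht =>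
      norm_inv_one_sub_mul_pow_le (hIcc ht) hρ hz₀ρ.le n
  · exact hφm.mul (Measurable.aestronglyMeasurable (by fun_prop))
  · refine Eventually.of_forall fun t ht z (hz : z.re < ρ) => ?_
    have hnt : ‖(n : ℂ) * t‖ ≤ n := by
      rw [norm_mul, Complex.norm_natCast, Complex.norm_real, Real.norm_of_nonneg (hIcc ht).1]
      exact mul_le_of_le_one_right n.cast_nonneg (hIcc ht).2
    rw [norm_mul, norm_mul]
    gcongr
    exact norm_inv_one_sub_mul_pow_le (hIcc ht) hρ hz.le (n + 1)
  · refine Eventually.of_forall fun t ht z (hz : z.re < ρ) => ?_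
    refine (hasDerivAt_inv_one_sub_mul_pow (norm_pos_iff.1 ?_) n).const_mul (φ t)
    exact (lt_min one_pos (by linarith)).trans_le
      (min_one_one_sub_re_le_norm_one_sub_mul (hIcc ht) z)

lemma analyticOnNhd_integral_mul_inv_one_sub_mul_pow {φ : ℝ → ℝ}
    (hφ : IntervalIntegrable φ volume 0 1) (n : ℕ) :
    AnalyticOnNhd ℝ (fun x => ∫ t in (0 : ℝ)..1, φ t * ((1 - t * x) ^ n)⁻¹) (Set.Iio 1) := by
  intro x hx
  have hdiff : DifferentiableOn ℂ
      (fun z : ℂ => ∫ t in (0 : ℝ)..1, (φ t : ℂ) * ((1 - t * z) ^ n)⁻¹) {z : ℂ | z.re < 1} :=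
    fun z hz => (differentiableAt_integral_mul_inv_one_sub_mul_pow
      ⟨hφ.1.ofReal, hφ.2.ofReal⟩ n hz).differentiableWithinAt
  convert (hdiff.analyticOnNhd (isOpen_lt Complex.continuous_re continuous_const) (x : ℂ)
    (by simpa using hx)).re_ofReal using 1
  ext y
  rw [← Complex.ofReal_re (∫ t in (0 : ℝ)..1, φ t * ((1 - t * y) ^ n)⁻¹),
    ← intervalIntegral.integral_ofReal]
  push_cast
  rfl

lemma hasSum_integral_mul_inv_one_sub_mul_pow {φ : ℝ → ℝ}
    (hφ : IntervalIntegrable φ volume 0 1) (m : ℕ) {x : ℝ} (hx : |x| < 1) :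
    HasSum (fun n : ℕ => ((n + m).choose m : ℝ) * x ^ n * ∫ t in (0 : ℝ)..1, φ t * t ^ n)
      (∫ t in (0 : ℝ)..1, φ t * ((1 - t * x) ^ (m + 1))⁻¹) := by
  have hsum : Summable fun n : ℕ => ((n + m).choose m : ℝ) * |x| ^ n :=
    summable_choose_mul_geometric_of_norm_lt_one m (by simpa using hx)
  have hdom := intervalIntegral.hasSum_integral_of_dominated_convergence (μ := volume)
    (a := 0) (b := 1)
    (F := fun (n : ℕ) t => φ t * (((n + m).choose m : ℝ) * (t * x) ^ n))
    (f := fun t => φ t * ((1 - t * x) ^ (m + 1))⁻¹)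
    (fun n t => ‖φ t‖ * (((n + m).choose m : ℝ) * |x| ^ n))
    (fun n => hφ.def'.1.mul (by fun_prop)) ?_ ?_ ?_ ?_
  · refine hdom.congr_fun fun n => ?_
    rw [← intervalIntegral.integral_const_mul]
    refine intervalIntegral.integral_congr fun t _ => ?_
    rw [mul_pow]
    ring
  · refine fun n => Eventually.of_forall fun t ht => ?_
    rw [Set.uIoc_of_le zero_le_one] at ht
    rw [norm_mul, norm_mul, norm_pow, norm_mul, Real.norm_natCast, Real.norm_of_nonneg ht.1.le,
      Real.norm_eq_abs x]
    gcongr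
    · exact mul_nonneg ht.1.le (abs_nonneg x)
    · exact mul_le_of_le_one_left (abs_nonneg x) ht.2
  · exact Eventually.of_forall fun t _ => hsum.mul_left _
  · simp only [tsum_mul_left]
    exact hφ.norm.mul_const _
  · refine Eventually.of_forall fun t ht => HasSum.mul_left _ ?_
    rw [Set.uIoc_of_le zero_le_one] at ht
    have htx : ‖t * x‖ < 1 := by
      rw [norm_mul, Real.norm_of_nonneg ht.1.le]
      exact (mul_le_of_le_one_left (norm_nonneg x) ht.2).trans_lt hx
    simpa using hasSum_choose_mul_geometric_of_norm_lt_one m htx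

/-- The continuation of `₂F₁(-δ, m; 1 - δ; x)` to `x < 1` (see `gaussHyp_eq_hypEuler`), in the form
that an integration by parts gives to Euler's integral `-δ ∫₀¹ t^(-δ-1) (1 - t x)^(-m) dt`, which
itself diverges for `0 < δ`. -/
def hypEuler (δ : ℝ) (m : ℕ) (x : ℝ) : ℝ :=
  ((1 - x) ^ m)⁻¹ - m * x * ∫ t in (0 : ℝ)..1, t ^ (-δ) * ((1 - t * x) ^ (m + 1))⁻¹

lemma analyticOnNhd_hypEuler {δ : ℝ} (hδ : δ < 1) (m : ℕ) :
    AnalyticOnNhd ℝ (hypEuler δ m) (Set.Iio 1) := by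
  have hint := analyticOnNhd_integral_mul_inv_one_sub_mul_pow
    (intervalIntegral.intervalIntegrable_rpow' (r := -δ) (by linarith)) (m + 1)
  intro x hx
  have hne : (1 - x) ^ m ≠ 0 := pow_ne_zero _ (sub_ne_zero.2 (ne_of_gt hx))
  exact (((analyticAt_const.sub analyticAt_id).pow m).inv hne).sub
    ((analyticAt_const.mul analyticAt_id).mul (hint x hx))

lemma integral_rpow_neg_mul_pow {δ : ℝ} (hδ : δ < 1) (n : ℕ) :
    ∫ t in (0 : ℝ)..1, t ^ (-δ) * t ^ n = 1 / (n + 1 - δ) := by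
  have hcongr : ∀ᵐ t : ℝ, t ∈ Set.uIoc (0 : ℝ) 1 → t ^ (-δ) * t ^ n = t ^ (n - δ) := by
    refine Eventually.of_forall fun t ht => ?_
    rw [Set.uIoc_of_le zero_le_one] at ht
    rw [← Real.rpow_natCast, ← Real.rpow_add ht.1, neg_add_eq_sub]
  rw [intervalIntegral.integral_congr_ae hcongr,
    integral_rpow (Or.inl (by linarith [n.cast_nonneg (α := ℝ)])),
    Real.one_rpow, Real.zero_rpow (by linarith [n.cast_nonneg (α := ℝ)]), sub_zero]
  ring_nf

lemma add_choose_mul_eq (n k : ℕ) :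
    ((n + 1 + k).choose k : ℝ) * (n + 1) = (k + 1) * (n + (k + 1)).choose (k + 1) := by
  have h := Nat.choose_succ_right_eq (n + 1 + k) k
  rw [Nat.add_sub_cancel, show n + 1 + k = n + (k + 1) by ring] at h
  rw [show n + 1 + k = n + (k + 1) by ring, mul_comm ((k : ℝ) + 1)]
  exact_mod_cast h.symm

lemma natCast_sub_ne_zero {δ : ℝ} (hδ0 : δ ≠ 0) (hδ : δ < 1) (n : ℕ) : (n : ℝ) - δ ≠ 0 := by
  rcases n with _ | n
  · simpa using hδ0
  · push_cast
    linarith [n.cast_nonneg (α := ℝ)]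

lemma hasSum_hypEuler {δ : ℝ} (hδ0 : δ ≠ 0) (hδ : δ < 1) (k : ℕ) {x : ℝ} (hx : |x| < 1) :
    HasSum (fun n : ℕ => ((n + k).choose k : ℝ) * x ^ n * (-δ / (n - δ)))
      (hypEuler δ (k + 1) x) := by
  have hgeom : HasSum (fun n : ℕ => ((n + k).choose k : ℝ) * x ^ n) ((1 - x) ^ (k + 1))⁻¹ := by
    simpa using hasSum_choose_mul_geometric_of_norm_lt_one (r := x) k (by simpa using hx)
  have hint : HasSum (fun n : ℕ => ((n + k).choose k : ℝ) * x ^ n * (n / (n - δ)))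
      ((k + 1 : ℕ) * x * ∫ t in (0 : ℝ)..1, t ^ (-δ) * ((1 - t * x) ^ (k + 1 + 1))⁻¹) := by
    rw [← hasSum_nat_add_iff' 1]
    simp only [Finset.range_one, Finset.sum_singleton, Nat.cast_zero, zero_div, mul_zero, sub_zero]
    refine ((hasSum_integral_mul_inv_one_sub_mul_pow
      (intervalIntegral.intervalIntegrable_rpow' (r := -δ) (by linarith)) (k + 1) hx).mul_left
        ((k + 1 : ℕ) * x)).congr_fun fun n => ?_
    rw [integral_rpow_neg_mul_pow hδ, pow_succ]
    push_cast
    linear_combination x ^ n * x / (n + 1 - δ) * add_choose_mul_eq n k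
  refine (hgeom.sub hint).congr_fun fun n => ?_
  have hne := natCast_sub_ne_zero hδ0 hδ n
  field_simp
  ring

lemma ascPochhammer_eval_mul_add {R : Type*} [CommRing R] (a : R) (n : ℕ) :
    (ascPochhammer R n).eval a * (a + n) = a * (ascPochhammer R n).eval (a + 1) := by
  rw [← ascPochhammer_succ_eval, ascPochhammer_succ_left]
  simp

lemma hypEuler_eq_ordinaryHypergeometric {δ : ℝ} (hδ0 : δ ≠ 0) (hδ : δ < 1) (k : ℕ) {x : ℝ}
    (hx : |x| < 1) :
    hypEuler δ (k + 1) x = ordinaryHypergeometric (-δ) ((k + 1 : ℕ) : ℝ) (1 - δ) x := by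
  rw [ordinaryHypergeometric_eq_tsum, ← (hasSum_hypEuler hδ0 hδ k hx).tsum_eq]
  refine tsum_congr fun n => ?_
  have hne := natCast_sub_ne_zero hδ0 hδ n
  have hpos : (ascPochhammer ℝ n).eval (1 - δ) ≠ 0 :=
    (ascPochhammer_pos n (1 - δ) (by linarith)).ne'
  have hshift := ascPochhammer_eval_mul_add (-δ) n
  rw [neg_add_eq_sub, neg_add_eq_sub] at hshift
  have hnum : (ascPochhammer ℝ n).eval ((k + 1 : ℕ) : ℝ) = n.factorial * (n + k).choose k := by
    rw [← ascPochhammer_eval_cast, ascPochhammer_nat_eq_ascFactorial,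
      Nat.ascFactorial_eq_factorial_mul_choose, Nat.add_comm k n, Nat.choose_symm_add,
      Nat.cast_mul]
  have hfac : (n.factorial : ℝ) ≠ 0 := by positivity
  rw [hnum, eq_div_of_mul_eq hne hshift, smul_eq_mul]
  field_simp

lemma gaussHyp_eq_of_analyticOnNhd {a b c : ℝ} {F : ℝ → ℝ} (hF : AnalyticOnNhd ℝ F (Set.Iio 1))
    (hFs : ∀ x ∈ Set.Ioo (-1 : ℝ) 1, F x = ordinaryHypergeometric a b c x) {x : ℝ} (hx : x < 1) :
    gaussHyp a b c x = F x := by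
  have hex : ∃ F : ℝ → ℝ, AnalyticOnNhd ℝ F (Set.Iio 1) ∧
      ∀ x ∈ Set.Ioo (-1 : ℝ) 1, F x = ordinaryHypergeometric a b c x := ⟨F, hF, hFs⟩
  rw [gaussHyp, dif_pos hex]
  refine hex.choose_spec.1.eqOn_of_preconnected_of_eventuallyEq hF
    isPreconnected_Iio (Set.mem_Iio.2 one_pos) ?_ hx
  filter_upwards [Ioo_mem_nhds (neg_one_lt_zero (R := ℝ)) one_pos] with y hy
  rw [hex.choose_spec.2 y hy, hFs y hy]

lemma gaussHyp_eq_hypEuler {δ : ℝ} (hδ0 : δ ≠ 0) (hδ : δ < 1) {N : ℕ} (hN : 0 < N) {x : ℝ}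
    (hx : x < 1) : gaussHyp (-δ) N (1 - δ) x = hypEuler δ N x := by
  obtain ⟨k, rfl⟩ : ∃ k, N = k + 1 := Nat.exists_eq_succ_of_ne_zero hN.ne'
  exact gaussHyp_eq_of_analyticOnNhd (analyticOnNhd_hypEuler hδ _)
    (fun y hy => hypEuler_eq_ordinaryHypergeometric hδ0 hδ k (abs_lt.2 hy)) hx

end Hypergeometric

section BetaPrime

lemma lintegral_rpow_mul_exp_neg_mul_Ioi {a r : ℝ} (ha : 0 < a) (hr : 0 < r) :
    ∫⁻ y in Set.Ioi 0, ENNReal.ofReal (y ^ (a - 1) * Real.exp (-(r * y))) =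
      ENNReal.ofReal ((1 / r) ^ a * Real.Gamma a) := by
  have hint : IntegrableOn (fun y : ℝ => y ^ (a - 1) * Real.exp (-(r * y))) (Set.Ioi 0) := by
    simpa using integrableOn_rpow_mul_exp_neg_mul_rpow (s := a - 1) (by linarith) one_pos hr
  rw [← Real.integral_rpow_mul_exp_neg_mul_Ioi ha hr]
  refine (ofReal_integral_eq_lintegral_ofReal hint ?_).symm
  filter_upwards [ae_restrict_mem measurableSet_Ioi] with y hy
  exact mul_nonneg (Real.rpow_nonneg (le_of_lt hy) _) (Real.exp_pos _).le

lemma lintegral_rpow_mul_one_add_rpow_neg_Ioi {a b : ℝ} (ha : 0 < a) (hb : 0 < b) :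
    ∫⁻ s in Set.Ioi 0, ENNReal.ofReal (s ^ (a - 1) * (1 + s) ^ (-(a + b))) =
      ENNReal.ofReal (Real.Gamma a * Real.Gamma b / Real.Gamma (a + b)) := by
  set ν : Measure ℝ := volume.restrict (Set.Ioi 0)
  have hΓ : 0 < Real.Gamma (a + b) := Real.Gamma_pos_of_pos (by positivity)
  let F (s y : ℝ) : ℝ := s ^ (a - 1) * (y ^ (a + b - 1) * Real.exp (-((1 + s) * y)))
  have hF : Measurable (Function.uncurry F) := by
    simp only [F, Function.uncurry_def]
    fun_prop
  have inner_y : ∀ᵐ s ∂ν, ∫⁻ y, ENNReal.ofReal (F s y) ∂ν =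
      ENNReal.ofReal (s ^ (a - 1) * (1 + s) ^ (-(a + b))) *
        ENNReal.ofReal (Real.Gamma (a + b)) := by
    filter_upwards [ae_restrict_mem measurableSet_Ioi] with s (hs : 0 < s)
    have hpow : 0 ≤ s ^ (a - 1) := by positivity
    simp only [F, ENNReal.ofReal_mul hpow]
    rw [lintegral_const_mul _ (by fun_prop),
      lintegral_rpow_mul_exp_neg_mul_Ioi (by positivity) (by positivity),
      ENNReal.ofReal_mul (by positivity), one_div, Real.inv_rpow (by positivity),
      ← Real.rpow_neg (by positivity), mul_assoc]
  have inner_s : ∀ᵐ y ∂ν, ∫⁻ s, ENNReal.ofReal (F s y) ∂ν =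
      ENNReal.ofReal (Real.Gamma a) * ENNReal.ofReal (y ^ (b - 1) * Real.exp (-(1 * y))) := by
    filter_upwards [ae_restrict_mem measurableSet_Ioi] with y (hy : 0 < y)
    have hsplit (s : ℝ) : F s y =
        y ^ (a + b - 1) * Real.exp (-y) * (s ^ (a - 1) * Real.exp (-(y * s))) := by
      simp only [F, show -((1 + s) * y) = -(y * s) + -y by ring, Real.exp_add]
      ring
    have hcoef : 0 ≤ y ^ (a + b - 1) * Real.exp (-y) := by positivity
    simp only [hsplit, ENNReal.ofReal_mul hcoef]
    rw [lintegral_const_mul _ (by fun_prop), lintegral_rpow_mul_exp_neg_mul_Ioi ha hy,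
      ← ENNReal.ofReal_mul hcoef, ← ENNReal.ofReal_mul (Real.Gamma_pos_of_pos ha).le, one_div,
      Real.inv_rpow hy.le, show a + b - 1 = a + (b - 1) by ring, Real.rpow_add hy, one_mul]
    field_simp
  have hswap := lintegral_lintegral_swap (μ := ν) (ν := ν) (f := fun s y => ENNReal.ofReal (F s y))
    hF.ennreal_ofReal.aemeasurable
  rw [lintegral_congr_ae inner_y, lintegral_congr_ae inner_s, lintegral_mul_const _ (by fun_prop),
    lintegral_const_mul _ (by fun_prop), lintegral_rpow_mul_exp_neg_mul_Ioi hb one_pos] at hswap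
  rw [ENNReal.ofReal_div_of_pos hΓ, ENNReal.eq_div_iff (by simpa using hΓ) ENNReal.ofReal_ne_top,
    mul_comm, hswap, ← ENNReal.ofReal_mul (Real.Gamma_pos_of_pos ha).le]
  simp

lemma integrableOn_rpow_mul_one_add_rpow_neg_Ioi {a b : ℝ} (ha : 0 < a) (hb : 0 < b) :
    IntegrableOn (fun s : ℝ => s ^ (a - 1) * (1 + s) ^ (-(a + b))) (Set.Ioi 0) := by
  rw [IntegrableOn, ← lintegral_ofReal_ne_top_iff_integrable
    (Measurable.aestronglyMeasurable (by fun_prop)),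
    lintegral_rpow_mul_one_add_rpow_neg_Ioi ha hb]
  · exact ENNReal.ofReal_ne_top
  · filter_upwards [ae_restrict_mem measurableSet_Ioi] with s (hs : 0 < s)
    change 0 ≤ s ^ (a - 1) * (1 + s) ^ (-(a + b))
    positivity

lemma integral_rpow_mul_one_add_rpow_neg_Ioi {a b : ℝ} (ha : 0 < a) (hb : 0 < b) :
    ∫ s in Set.Ioi (0 : ℝ), s ^ (a - 1) * (1 + s) ^ (-(a + b)) =
      Real.Gamma a * Real.Gamma b / Real.Gamma (a + b) := by
  rw [integral_eq_lintegral_of_nonneg_ae, lintegral_rpow_mul_one_add_rpow_neg_Ioi ha hb,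
    ENNReal.toReal_ofReal]
  · have := Real.Gamma_pos_of_pos ha
    have := Real.Gamma_pos_of_pos hb
    have := Real.Gamma_pos_of_pos (add_pos ha hb)
    positivity
  · filter_upwards [ae_restrict_mem measurableSet_Ioi] with s (hs : 0 < s)
    change 0 ≤ s ^ (a - 1) * (1 + s) ^ (-(a + b))
    positivity
  · exact Measurable.aestronglyMeasurable (by fun_prop)

end BetaPrime

section RadialIntegral

lemma rpow_neg_mul_inv_one_add_pow {δ s : ℝ} (hs : 0 < s) (m : ℕ) :
    s ^ (-δ) * ((1 + s) ^ (m + 1))⁻¹ = s ^ (1 - δ - 1) * (1 + s) ^ (-(1 - δ + (m + δ))) := by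
  rw [show 1 - δ - 1 = -δ by ring, show 1 - δ + (m + δ) = ((m + 1 : ℕ) : ℝ) by push_cast; ring,
    Real.rpow_neg (by positivity) ((m + 1 : ℕ) : ℝ), Real.rpow_natCast]

lemma integrableOn_rpow_neg_mul_inv_one_add_pow {δ : ℝ} (hδ0 : 0 < δ) (hδ : δ < 1) (m : ℕ) :
    IntegrableOn (fun s : ℝ => s ^ (-δ) * ((1 + s) ^ (m + 1))⁻¹) (Set.Ioi 0) :=
  (integrableOn_rpow_mul_one_add_rpow_neg_Ioi (sub_pos.2 hδ) (by positivity)).congr_fun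
    (fun _ hs => (rpow_neg_mul_inv_one_add_pow hs m).symm) measurableSet_Ioi

lemma integral_rpow_neg_mul_inv_one_add_pow {δ : ℝ} (hδ0 : 0 < δ) (hδ : δ < 1) (m : ℕ) :
    ∫ s in Set.Ioi (0 : ℝ), s ^ (-δ) * ((1 + s) ^ (m + 1))⁻¹ =
      Real.Gamma (1 - δ) * Real.Gamma (m + δ) / Real.Gamma (m + 1) := by
  rw [setIntegral_congr_fun measurableSet_Ioi fun s hs => rpow_neg_mul_inv_one_add_pow hs m,
    integral_rpow_mul_one_add_rpow_neg_Ioi (sub_pos.2 hδ) (by positivity)]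
  ring_nf

lemma rpow_mul_hypEuler_neg {δ : ℝ} (m : ℕ) {z : ℝ} (hz : 0 < z) :
    z ^ (-δ) * hypEuler δ m (-z) = z ^ (-δ) * ((1 + z) ^ m)⁻¹ +
      m * ∫ s in (0 : ℝ)..z, s ^ (-δ) * ((1 + s) ^ (m + 1))⁻¹ := by
  have hscale : ∫ s in (0 : ℝ)..z, s ^ (-δ) * ((1 + s) ^ (m + 1))⁻¹ =
      z * ∫ t in (0 : ℝ)..1, (t * z) ^ (-δ) * ((1 + t * z) ^ (m + 1))⁻¹ := by
    rw [intervalIntegral.integral_comp_mul_right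
      (fun s : ℝ => s ^ (-δ) * ((1 + s) ^ (m + 1))⁻¹) hz.ne', zero_mul, one_mul, smul_eq_mul,
      mul_inv_cancel_left₀ hz.ne']
  have hpull : ∫ t in (0 : ℝ)..1, (t * z) ^ (-δ) * ((1 + t * z) ^ (m + 1))⁻¹ =
      z ^ (-δ) * ∫ t in (0 : ℝ)..1, t ^ (-δ) * ((1 - t * -z) ^ (m + 1))⁻¹ := by
    rw [← intervalIntegral.integral_const_mul]
    refine intervalIntegral.integral_congr fun t ht => ?_
    rw [Set.uIcc_of_le zero_le_one] at ht
    simp only [mul_neg, sub_neg_eq_add]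
    rw [Real.mul_rpow ht.1 hz.le]
    ring
  rw [hscale, hpull, hypEuler, sub_neg_eq_add]
  ring

lemma hasDerivAt_inv_one_add_pow {z : ℝ} (hz : 1 + z ≠ 0) (m : ℕ) :
    HasDerivAt (fun z : ℝ => ((1 + z) ^ m)⁻¹) (-(m * ((1 + z) ^ (m + 1))⁻¹)) z := by
  refine ((((hasDerivAt_id' z).const_add 1).fun_pow m).fun_inv (pow_ne_zero _ hz)).congr_deriv ?_
  rcases m with _ | k
  · simp
  · simp only [Nat.add_sub_cancel, mul_one]
    field_simp
    ring

lemma hasDerivAt_rpow_mul_hypEuler_neg {δ : ℝ} (hδ0 : 0 < δ) (hδ : δ < 1) (m : ℕ) {z : ℝ}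
    (hz : 0 < z) :
    HasDerivAt (fun z => z ^ (-δ) * hypEuler δ m (-z))
      (-δ * z ^ (-δ - 1) * ((1 + z) ^ m)⁻¹) z := by
  have hpow : HasDerivAt (fun z : ℝ => z ^ (-δ)) (-δ * z ^ (-δ - 1)) z :=
    Real.hasDerivAt_rpow_const (Or.inl hz.ne')
  have hint : HasDerivAt (fun z => ∫ s in (0 : ℝ)..z, s ^ (-δ) * ((1 + s) ^ (m + 1))⁻¹)
      (z ^ (-δ) * ((1 + z) ^ (m + 1))⁻¹) z := by
    refine intervalIntegral.integral_hasDerivAt_right ?_ ?_ ?_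
    · rw [intervalIntegrable_iff_integrableOn_Ioc_of_le hz.le]
      exact (integrableOn_rpow_neg_mul_inv_one_add_pow hδ0 hδ m).mono_set Set.Ioc_subset_Ioi_self
    · exact (Measurable.stronglyMeasurable (by fun_prop)).stronglyMeasurableAtFilter
    · exact (Real.continuousAt_rpow_const _ _ (Or.inl hz.ne')).mul
        (ContinuousAt.inv₀ (by fun_prop) (by positivity))
  have hsum := (hpow.mul (hasDerivAt_inv_one_add_pow (by positivity) m)).add
    (hint.const_mul (m : ℝ))
  refine (hsum.congr_of_eventuallyEq ?_).congr_deriv (by ring)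
  filter_upwards [Ioi_mem_nhds hz] with y hy using rpow_mul_hypEuler_neg m hy

lemma tendsto_rpow_mul_hypEuler_neg {δ : ℝ} (hδ0 : 0 < δ) (hδ : δ < 1) {m : ℕ} (hm : 0 < m) :
    Tendsto (fun z => z ^ (-δ) * hypEuler δ m (-z)) atTop
      (𝓝 (Real.Gamma (1 - δ) * Real.Gamma (m + δ) * (Real.Gamma m)⁻¹)) := by
  have hint := intervalIntegral_tendsto_integral_Ioi 0
    (integrableOn_rpow_neg_mul_inv_one_add_pow hδ0 hδ m) tendsto_id
  have hbdry : Tendsto (fun z : ℝ => z ^ (-δ) * ((1 + z) ^ m)⁻¹) atTop (𝓝 (0 * 0)) := by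
    refine (tendsto_rpow_neg_atTop hδ0).mul (Tendsto.inv_tendsto_atTop ?_)
    exact (tendsto_pow_atTop hm.ne').comp (tendsto_atTop_add_const_left _ _ tendsto_id)
  have hlim : (0 : ℝ) * 0 +
      m * (∫ s in Set.Ioi (0 : ℝ), s ^ (-δ) * ((1 + s) ^ (m + 1))⁻¹) =
      Real.Gamma (1 - δ) * Real.Gamma (m + δ) * (Real.Gamma m)⁻¹ := by
    rw [integral_rpow_neg_mul_inv_one_add_pow hδ0 hδ, Real.Gamma_add_one (by positivity)]
    field_simp
    ring
  rw [← hlim]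
  refine (hbdry.add (hint.const_mul (m : ℝ))).congr' ?_
  filter_upwards [eventually_gt_atTop 0] with z hz using (rpow_mul_hypEuler_neg m hz).symm

/-- The radial part `∫₀ᵛ 2 t (1 + x t^(-α))^(-N) dt` of the exponent of the Laplace transform, the
integrand being the Laplace transform of the fading after attenuation over the distance `t`. -/
def radialInt (α : ℝ) (N : ℕ) (x v : ℝ) : ℝ :=
  ∫ t in (0 : ℝ)..v, 2 * t * ((1 + x * t ^ (-α)) ^ N)⁻¹

lemma radialInt_zero_left (α : ℝ) (N : ℕ) (v : ℝ) : radialInt α N 0 v = v ^ 2 := by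
  simp only [radialInt, zero_mul, add_zero, one_pow, inv_one, mul_one]
  rw [intervalIntegral.integral_const_mul, integral_id]
  ring

lemma inv_one_add_mul_rpow_pow_mem_Icc {α : ℝ} (N : ℕ) {x t : ℝ} (hx : 0 ≤ x) (ht : 0 ≤ t) :
    ((1 + x * t ^ (-α)) ^ N)⁻¹ ∈ Set.Icc (0 : ℝ) 1 := by
  have h : 0 ≤ x * t ^ (-α) := mul_nonneg hx (Real.rpow_nonneg ht _)
  exact ⟨by positivity, inv_le_one_of_one_le₀ (one_le_pow₀ (by linarith))⟩

lemma norm_radial_integrand_le {α : ℝ} (N : ℕ) {x t v : ℝ} (hx : 0 ≤ x) (ht : t ∈ Set.Ioc 0 v) :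
    ‖2 * t * ((1 + x * t ^ (-α)) ^ N)⁻¹‖ ≤ 2 * v := by
  obtain ⟨hnonneg, hle⟩ := inv_one_add_mul_rpow_pow_mem_Icc (α := α) N hx ht.1.le
  rw [Real.norm_of_nonneg (mul_nonneg (by linarith [ht.1]) hnonneg)]
  exact (mul_le_of_le_one_right (by linarith [ht.1]) hle).trans (by linarith [ht.2])

lemma intervalIntegrable_radial {α : ℝ} (N : ℕ) {x v : ℝ} (hx : 0 ≤ x) (hv : 0 ≤ v) :
    IntervalIntegrable (fun t => 2 * t * ((1 + x * t ^ (-α)) ^ N)⁻¹) volume 0 v := by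
  rw [intervalIntegrable_iff_integrableOn_Ioc_of_le hv]
  exact Measure.integrableOn_of_bounded (M := 2 * v) (by simp)
    (Measurable.aestronglyMeasurable (by fun_prop))
    ((ae_restrict_mem measurableSet_Ioc).mono fun t ht => norm_radial_integrand_le N hx ht)

lemma continuous_radialInt_comp {β : Type*} [TopologicalSpace β] [FirstCountableTopology β]
    {α : ℝ} (N : ℕ) {x : β → ℝ} (hx : Continuous x) (hx0 : ∀ w, 0 ≤ x w) {v : ℝ} (hv : 0 ≤ v) :
    Continuous fun w => radialInt α N (x w) v := by
  refine intervalIntegral.continuous_of_dominated_interval (bound := fun _ => 2 * v)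
    (fun w => Measurable.aestronglyMeasurable (by fun_prop)) (fun w => ?_) (by simp) ?_
  · refine Eventually.of_forall fun t ht => ?_
    rw [Set.uIoc_of_le hv] at ht
    exact norm_radial_integrand_le N (hx0 w) ht
  · refine Eventually.of_forall fun t ht => ?_
    rw [Set.uIoc_of_le hv] at ht
    refine continuous_const.mul (Continuous.inv₀ (by fun_prop) fun w => ?_)
    have h : 0 ≤ x w * t ^ (-α) := mul_nonneg (hx0 w) (Real.rpow_nonneg ht.1.le _)
    exact pow_ne_zero _ (by linarith)

lemma radialInt_eq_of_hasDerivAt {α : ℝ} (hα : 0 < α) {N : ℕ} {T : ℝ → ℝ} {L : ℝ}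
    (hT : ∀ z > 0, HasDerivAt T (-(2 / α) * z ^ (-(2 / α) - 1) * ((1 + z) ^ N)⁻¹) z)
    (hL : Tendsto T atTop (𝓝 L)) {x v : ℝ} (hx : 0 < x) (hv : 0 < v) :
    radialInt α N x v = x ^ (2 / α) * (T (x * v ^ (-α)) - L) := by
  have hpow {t : ℝ} (ht : 0 < t) :
      (x * t ^ (-α)) ^ (-(2 / α) - 1) = t ^ 2 / (x ^ (2 / α) * (x * t ^ (-α))) := by
    have hα2 : -α * -(2 / α) = 2 := by field_simp
    rw [Real.rpow_sub (by positivity), Real.rpow_one, Real.mul_rpow hx.le (by positivity),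
      ← Real.rpow_mul ht.le, hα2, Real.rpow_neg hx.le, Real.rpow_two]
    field_simp
  have hderiv {t : ℝ} (ht : 0 < t) : HasDerivAt (fun t => x ^ (2 / α) * T (x * t ^ (-α)))
      (2 * t * ((1 + x * t ^ (-α)) ^ N)⁻¹) t := by
    have hz : 0 < x * t ^ (-α) := by positivity
    have hinner : HasDerivAt (fun t : ℝ => x * t ^ (-α)) (x * (-α * t ^ (-α - 1))) t :=
      (Real.hasDerivAt_rpow_const (Or.inl ht.ne')).const_mul x
    refine (((hT _ hz).comp t hinner).const_mul (x ^ (2 / α))).congr_deriv ?_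
    rw [hpow ht, Real.rpow_sub ht, Real.rpow_one]
    field_simp
  have hzero : Tendsto (fun t => x ^ (2 / α) * T (x * t ^ (-α))) (𝓝[>] 0)
      (𝓝 (x ^ (2 / α) * L)) :=
    (hL.comp ((tendsto_rpow_neg_nhdsGT_zero (neg_lt_zero.2 hα)).const_mul_atTop hx)).const_mul _
  rw [radialInt, intervalIntegral.integral_eq_sub_of_hasDerivAt_of_tendsto hv
    (fun t ht => hderiv ht.1) (intervalIntegrable_radial N hx.le hv.le) hzero
    ((hderiv hv).continuousAt.tendsto.mono_left nhdsWithin_le_nhds), mul_sub]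

lemma radialInt_eq_hypS {α : ℝ} (hα : 2 < α) {N : ℕ} (hN : 0 < N) {x v : ℝ} (hx : 0 ≤ x)
    (hv : 0 < v) :
    radialInt α N x v = hypS α N 0 (x / v ^ α) * v ^ 2 - gammaDelta α N x := by
  have hδ0 : 0 < 2 / α := by positivity
  have hδ : 2 / α < 1 := (div_lt_one (by positivity)).2 hα
  have hS : hypS α N 0 (x / v ^ α) = hypEuler (2 / α) N (-(x / v ^ α)) := by
    rw [← gaussHyp_eq_hypEuler hδ0.ne' hδ hN, hypS]
    · simp
    · have hz : 0 ≤ x / v ^ α := by positivity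
      linarith
  rw [hS, gammaDelta]
  rcases hx.eq_or_lt with rfl | hx
  · simp [radialInt_zero_left, Real.zero_rpow hδ0.ne', hypEuler]
  rw [radialInt_eq_of_hasDerivAt (by positivity)
    (fun z hz => hasDerivAt_rpow_mul_hypEuler_neg hδ0 hδ N hz)
    (tendsto_rpow_mul_hypEuler_neg hδ0 hδ hN) hx hv]
  have hpow : x ^ (2 / α) * (x * v ^ (-α)) ^ (-(2 / α)) = v ^ 2 := by
    have hα2 : -α * -(2 / α) = 2 := by field_simp
    rw [Real.mul_rpow hx.le (by positivity), ← Real.rpow_mul hv.le, hα2, ← mul_assoc,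
      ← Real.rpow_add hx, add_neg_cancel, Real.rpow_zero, one_mul, Real.rpow_two]
  rw [mul_sub, ← mul_assoc, hpow, Real.rpow_neg hv.le, ← div_eq_mul_inv]
  ring

lemma Fy_succ (k : ℕ) (y : ℝ) :
    Fy (k + 1) y = (k + 1) * (Real.log (1 + 1 / y) -
      ∑ j ∈ Finset.range k, ((1 + y) ^ (j + 1))⁻¹ / (j + 1)) - (y * (1 + y) ^ k)⁻¹ := by
  have hsum : ∑ m ∈ Finset.Icc 1 k, ((k + 1 : ℕ) : ℝ) /
      ((1 + y) ^ (k + 1 - m) * (((k + 1 : ℕ) : ℝ) - m)) =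
      (k + 1) * ∑ j ∈ Finset.range k, ((1 + y) ^ (j + 1))⁻¹ / (j + 1) := by
    rw [Finset.mul_sum]
    refine Finset.sum_nbij' (fun m => k - m) (fun j => k - j)
      (by simp; omega) (by simp; omega) (by simp; omega) (by simp; omega) fun m hm => ?_
    have hm' : m ≤ k := (Finset.mem_Icc.1 hm).2
    rw [Nat.sub_add_comm hm', Nat.cast_sub hm']
    push_cast
    rw [show (k : ℝ) - m + 1 = k + 1 - m by ring, div_eq_mul_inv, mul_inv, div_eq_mul_inv]
  rw [Fy, Nat.add_sub_cancel, hsum]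
  push_cast
  ring

lemma hasDerivAt_log_sub_sum_inv_pow (k : ℕ) {y : ℝ} (hy : 0 < y) :
    HasDerivAt (fun y : ℝ => Real.log (1 + 1 / y) -
      ∑ j ∈ Finset.range k, ((1 + y) ^ (j + 1))⁻¹ / (j + 1)) (-(y * (1 + y) ^ (k + 1))⁻¹) y := by
  induction k with
  | zero =>
    have hinv : HasDerivAt (fun y : ℝ => 1 + 1 / y) (-(y ^ 2)⁻¹) y := by
      simpa using (hasDerivAt_inv hy.ne').const_add 1
    simp only [Finset.range_zero, Finset.sum_empty, sub_zero]
    refine (hinv.log (by positivity)).congr_deriv ?_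
    field_simp
    ring
  | succ k ih =>
    simp only [Finset.sum_range_succ, ← sub_sub]
    refine (ih.sub ((hasDerivAt_inv_one_add_pow (by positivity) (k + 1)).div_const
      ((k : ℝ) + 1))).congr_deriv ?_
    push_cast
    field_simp
    ring

lemma hasDerivAt_Fy {N : ℕ} (hN : 0 < N) {y : ℝ} (hy : 0 < y) :
    HasDerivAt (Fy N) ((y ^ 2 * (1 + y) ^ N)⁻¹) y := by
  obtain ⟨k, rfl⟩ : ∃ k, N = k + 1 := Nat.exists_eq_succ_of_ne_zero hN.ne'
  have hmid := ((hasDerivAt_inv hy.ne').mul (hasDerivAt_inv_one_add_pow (by positivity) k))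
  have hmain := (hasDerivAt_log_sub_sum_inv_pow k hy).const_mul ((k : ℝ) + 1)
  refine ((hmain.sub hmid).congr_of_eventuallyEq (Eventually.of_forall fun z => ?_)).congr_deriv ?_
  · rw [Fy_succ, mul_inv]
    rfl
  · field_simp
    ring

lemma tendsto_Fy_atTop {N : ℕ} (hN : 0 < N) : Tendsto (Fy N) atTop (𝓝 0) := by
  obtain ⟨k, rfl⟩ : ∃ k, N = k + 1 := Nat.exists_eq_succ_of_ne_zero hN.ne'
  have hadd : Tendsto (fun y : ℝ => 1 + y) atTop atTop :=
    tendsto_atTop_add_const_left _ _ tendsto_id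
  have hlog : Tendsto (fun y : ℝ => Real.log (1 + 1 / y)) atTop (𝓝 0) := by
    simpa using ((tendsto_inv_atTop_zero (𝕜 := ℝ)).const_add 1).log (by simp)
  have hsum : Tendsto (fun y : ℝ => ∑ j ∈ Finset.range k, ((1 + y) ^ (j + 1))⁻¹ / (j + 1)) atTop
      (𝓝 0) := by
    simpa using tendsto_finsetSum (Finset.range k) fun j _ =>
      (((tendsto_pow_atTop j.succ_ne_zero).comp hadd).inv_tendsto_atTop).div_const ((j : ℝ) + 1)
  have hmid : Tendsto (fun y : ℝ => (y * (1 + y) ^ k)⁻¹) atTop (𝓝 0) := by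
    refine (tendsto_atTop_mono' _ ?_ tendsto_id).inv_tendsto_atTop
    filter_upwards [eventually_ge_atTop 0] with y hy
    exact le_mul_of_one_le_right hy (one_le_pow₀ (by linarith))
  rw [funext (Fy_succ k)]
  simpa using ((hlog.sub hsum).const_mul ((k : ℝ) + 1)).sub hmid

lemma radialInt_eq_Fy {N : ℕ} (hN : 0 < N) {x v : ℝ} (hx : 0 < x) (hv : 0 < v) :
    radialInt 2 N x v = -(x * Fy N (x / v ^ 2)) := by
  have hderiv : ∀ z > 0, HasDerivAt (fun z => -Fy N z)
      (-(2 / 2) * z ^ (-(2 / 2 : ℝ) - 1) * ((1 + z) ^ N)⁻¹) z := by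
    intro z hz
    refine (hasDerivAt_Fy hN hz).neg.congr_deriv ?_
    rw [show -(2 / 2 : ℝ) - 1 = -2 by norm_num, Real.rpow_neg hz.le, Real.rpow_two, mul_inv]
    ring
  rw [radialInt_eq_of_hasDerivAt two_pos hderiv (tendsto_Fy_atTop hN).neg hx hv,
    Real.rpow_neg hv.le, Real.rpow_two, ← div_eq_mul_inv, div_self two_ne_zero, Real.rpow_one]
  ring

end RadialIntegral

section ChebyshevLimit

variable {Nc : ℕ} (Q : Params Nc) (f : Fin Nc)

lemma argX_nonneg (w : ℝ) {s τ : ℝ} (hs : 0 ≤ s) (hτ : 0 ≤ τ) : 0 ≤ argX Q w s τ :=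
  div_nonneg (mul_nonneg (mul_nonneg hs (arrayGain_nonneg _ _)) hτ) (Nat.cast_nonneg _)

lemma continuous_argX (s τ : ℝ) : Continuous fun w => argX Q w s τ :=
  ((continuous_const.mul (continuous_arrayGain Q.Nant_pos)).mul continuous_const).div_const _

lemma Wgt_eq_radialInt (hα : 2 < Q.α) {r : ℝ} (hr : 0 < r) (w : ℝ) {s τ : ℝ} (hs : 0 ≤ s)
    (hτ : 0 ≤ τ) :
    Wgt Q f r w s τ = Q.p f * radialInt Q.α Q.Nnak (argX Q w s τ) r -
      radialInt Q.α Q.Nnak (argX Q w s τ) Q.RL := by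
  have hX := argX_nonneg Q w hs hτ
  rw [radialInt_eq_hypS hα Q.Nnak_pos hX hr, radialInt_eq_hypS hα Q.Nnak_pos hX Q.RL_pos, Wgt]
  ring

lemma Weq_eq_radialInt (hα : Q.α = 2) {r : ℝ} (hr : 0 < r) (w : ℝ) {s τ : ℝ} (hs : 0 ≤ s)
    (hτ : 0 ≤ τ) :
    Weq Q f r w s τ = Q.p f * radialInt Q.α Q.Nnak (argX Q w s τ) r -
      radialInt Q.α Q.Nnak (argX Q w s τ) Q.RL := by
  rw [hα, Weq]
  split_ifs with h
  · simp only [h, radialInt_zero_left]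
  · have hX := (argX_nonneg Q w hs hτ).lt_of_ne' h
    rw [radialInt_eq_Fy Q.Nnak_pos hX hr, radialInt_eq_Fy Q.Nnak_pos hX Q.RL_pos]
    ring

lemma tendsto_closedForm (r : ℝ) {W : ℝ → ℝ} (hW : Continuous W) :
    Tendsto (closedForm Q f r W) atTop
      (𝓝 (Real.exp (-(Real.pi * Q.lam * (Q.RL ^ 2 - Q.p f * r ^ 2))
        - Real.pi * Q.lam / 2 * ∫ y in (-1 : ℝ)..1, W (y * Q.d / Q.wl)))) := by
  have hsum := tendsto_chebNode_sum (g := fun y => W (y * Q.d / Q.wl)) (by fun_prop)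
  refine ((Real.continuous_exp.tendsto _).comp
    ((hsum.const_mul (Real.pi * Q.lam / 2)).const_sub _)).congr fun u => ?_
  simp only [Function.comp_apply, closedForm]
  congr 2
  ring

end ChebyshevLimit

section Poisson

lemma ext_of_natCast_singleton {ρ ρ' : Measure ℕ∞} [IsProbabilityMeasure ρ]
    [IsProbabilityMeasure ρ'] (h : ∀ k : ℕ, ρ {(k : ℕ∞)} = ρ' {(k : ℕ∞)}) : ρ = ρ' := by
  have hcompl (σ : Measure ℕ∞) : σ {⊤}ᶜ = ∑' k : ℕ, σ {(k : ℕ∞)} := by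
    rw [← measure_iUnion (fun i j hij => by simpa using hij) fun _ => measurableSet_singleton _]
    congr 1
    ext a
    induction a using ENat.recTopCoe <;> simp
  refine Measure.ext_of_singleton fun a => ?_
  induction a using ENat.recTopCoe with
  | top =>
    rw [← compl_compl ({⊤} : Set ℕ∞), prob_compl_eq_one_sub (measurableSet_singleton _).compl,
      prob_compl_eq_one_sub (measurableSet_singleton _).compl, hcompl, hcompl, tsum_congr h]
  | coe k => exact h k

lemma integral_pow_poissonMeasure (r : NNReal) (v : ℝ) :
    ∫ k, v ^ k ∂(poissonMeasure r) = Real.exp (-(r * (1 - v))) := by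
  have hexp := (NormedSpace.expSeries_div_hasSum_exp (r * v)).mul_left (Real.exp (-r))
  rw [← Real.exp_eq_exp_ℝ, ← Real.exp_add] at hexp
  rw [integral_poissonMeasure, show -(r * (1 - v)) = -r + r * v by ring, ← hexp.tsum_eq]
  refine tsum_congr fun k => ?_
  rw [smul_eq_mul, mul_pow]
  ring

lemma poissonMeasure_real_Ici_two_le (r : NNReal) :
    (poissonMeasure r).real (Set.Ici 2) ≤ r ^ 2 := by
  have hcompl : (Set.Ici 2 : Set ℕ) = {0, 1}ᶜ := by
    ext k
    simp
    omega
  have hexp : 1 - (r : ℝ) ≤ Real.exp (-r) := by linarith [Real.add_one_le_exp (-(r : ℝ))]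
  rw [hcompl, probReal_compl_eq_one_sub MeasurableSet.of_discrete, Set.insert_eq,
    measureReal_union (by simp) (measurableSet_singleton _), poissonMeasure_real_singleton,
    poissonMeasure_real_singleton]
  simp only [pow_zero, Nat.factorial_zero, Nat.cast_one, pow_one, Nat.factorial_one, div_one,
    mul_one]
  nlinarith [r.coe_nonneg]

variable {Ω : Type*} [MeasurableSpace Ω] {μ : Measure Ω} {lam : ℝ} {X : ℕ → Ω → Plane}

lemma IsHPPP.measurable_count (h : IsHPPP μ lam X) {A : Set Plane} (hA : MeasurableSet A) :
    Measurable fun ω => {n | X n ω ∈ A}.encard :=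
  measurable_encard.comp <| measurable_set_iff.2 fun n =>
    measurableSet_setOfPred.1 (h.measurable n hA)

variable [IsProbabilityMeasure μ]

lemma IsHPPP.map_count (h : IsHPPP μ lam X) {A : Set Plane} (hA : MeasurableSet A)
    (hb : Bornology.IsBounded A) :
    μ.map (fun ω => {n | X n ω ∈ A}.encard) =
      (poissonMeasure (lam * (volume A).toReal).toNNReal).map ((↑) : ℕ → ℕ∞) := by
  have hm := h.measurable_count hA
  have := Measure.isProbabilityMeasure_map (μ := μ) hm.aemeasurable
  have := Measure.isProbabilityMeasure_map
    (μ := poissonMeasure (lam * (volume A).toReal).toNNReal)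
    (Measurable.of_discrete (f := ((↑) : ℕ → ℕ∞))).aemeasurable
  refine ext_of_natCast_singleton fun k => ?_
  have hpre : ((↑) : ℕ → ℕ∞) ⁻¹' {(k : ℕ∞)} = {k} := by
    ext j
    simp
  rw [Measure.map_apply hm (measurableSet_singleton _),
    Measure.map_apply Measurable.of_discrete (measurableSet_singleton _), hpre]
  exact h.poisson A hA hb k

lemma IsHPPP.ae_finite (h : IsHPPP μ lam X) {A : Set Plane} (hA : MeasurableSet A)
    (hb : Bornology.IsBounded A) : ∀ᵐ ω ∂μ, {n | X n ω ∈ A}.Finite := by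
  have hlaw : ∀ᵐ a ∂(μ.map fun ω => {n | X n ω ∈ A}.encard), a ≠ ⊤ := by
    rw [h.map_count hA hb, ae_map_iff Measurable.of_discrete.aemeasurable
      MeasurableSet.of_discrete]
    exact Eventually.of_forall ENat.natCast_ne_top
  filter_upwards [ae_of_ae_map (h.measurable_count hA).aemeasurable hlaw] with ω hω
  exact Set.encard_ne_top_iff.1 hω

lemma IsHPPP.measureReal_two_le_count (h : IsHPPP μ lam X) (hlam : 0 ≤ lam) {A : Set Plane}
    (hA : MeasurableSet A) (hb : Bornology.IsBounded A) :
    μ.real {ω | 2 ≤ {n | X n ω ∈ A}.encard} ≤ (lam * (volume A).toReal) ^ 2 := by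
  have hpre : ((↑) : ℕ → ℕ∞) ⁻¹' Set.Ici 2 = Set.Ici 2 := by
    ext k
    exact Nat.ofNat_le_cast (α := ℕ∞) (m := 2)
  have hlaw := congrArg (fun ρ : Measure ℕ∞ => ρ.real (Set.Ici 2)) (h.map_count hA hb)
  simp only [map_measureReal_apply (h.measurable_count hA) MeasurableSet.of_discrete,
    map_measureReal_apply (Measurable.of_discrete (f := ((↑) : ℕ → ℕ∞)))
      MeasurableSet.of_discrete, hpre] at hlaw
  calc μ.real {ω | 2 ≤ {n | X n ω ∈ A}.encard}
      = (poissonMeasure (lam * (volume A).toReal).toNNReal).real (Set.Ici 2) := hlaw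
    _ ≤ ((lam * (volume A).toReal).toNNReal : ℝ) ^ 2 := poissonMeasure_real_Ici_two_le _
    _ = (lam * (volume A).toReal) ^ 2 := by rw [Real.coe_toNNReal _ (by positivity)]

lemma IsHPPP.integral_pow_count (h : IsHPPP μ lam X) (hlam : 0 ≤ lam) {A : Set Plane}
    (hA : MeasurableSet A) (hb : Bornology.IsBounded A) (v : ℝ) :
    ∫ ω, v ^ ({n | X n ω ∈ A}.encard.toNat) ∂μ =
      Real.exp (-(lam * (volume A).toReal * (1 - v))) := by
  have hpow : StronglyMeasurable fun a : ℕ∞ => v ^ a.toNat :=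
    Measurable.of_discrete.stronglyMeasurable
  rw [← integral_map (f := fun a : ℕ∞ => v ^ a.toNat) (h.measurable_count hA).aemeasurable
    hpow.aestronglyMeasurable, h.map_count hA hb,
    integral_map Measurable.of_discrete.aemeasurable hpow.aestronglyMeasurable]
  simp only [ENat.toNat_natCast]
  rw [integral_pow_poissonMeasure, Real.coe_toNNReal _ (by positivity)]

lemma IsHPPP.integral_prod_pow_count (h : IsHPPP μ lam X) (hlam : 0 ≤ lam) {ι : Type*}
    [Fintype ι] {A : ι → Set Plane} (hA : ∀ i, MeasurableSet (A i))
    (hb : ∀ i, Bornology.IsBounded (A i)) (hd : Pairwise fun i j => Disjoint (A i) (A j))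
    (v : ι → ℝ) :
    ∫ ω, ∏ i, v i ^ ({n | X n ω ∈ A i}.encard.toNat) ∂μ =
      Real.exp (-(lam * ∑ i, (volume (A i)).toReal * (1 - v i))) := by
  let e := (Fintype.equivFin ι).symm
  have hreindex (ω : Ω) : ∏ i, v (e i) ^ ({n | X n ω ∈ A (e i)}.encard.toNat) =
      ∏ i, v i ^ ({n | X n ω ∈ A i}.encard.toNat) :=
    Equiv.prod_comp e fun i => v i ^ ({n | X n ω ∈ A i}.encard.toNat)
  have hindep := (h.indep _ (A ∘ e) (fun i => hA _) (fun i => hb _)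
    (hd.comp_of_injective e.injective)).comp (fun i (a : ℕ∞) => v (e i) ^ a.toNat)
    fun i => Measurable.of_discrete
  have hprod := hindep.integral_fun_prod_eq_prod_integral fun i =>
    (Measurable.of_discrete.comp (h.measurable_count (hA (e i)))).aestronglyMeasurable
  simp only [Function.comp_apply, hreindex, Equiv.prod_comp e
    (fun i => ∫ ω, v i ^ ({n | X n ω ∈ A i}.encard.toNat) ∂μ)] at hprod
  rw [hprod, Finset.mul_sum, ← Finset.sum_neg_distrib, Real.exp_sum]
  refine Finset.prod_congr rfl fun i _ => ?_
  rw [h.integral_pow_count hlam (hA i) (hb i), mul_assoc]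

lemma finprod_comp_eq_prod_toFinset {ι α M : Type*} [CommMonoid M] {x : ι → α} {B : Set α}
    (hfin : {i | x i ∈ B}.Finite) {ψ : α → M} (hψ : ∀ a ∉ B, ψ a = 1) :
    ∏ᶠ i, ψ (x i) = ∏ i ∈ hfin.toFinset, ψ (x i) := by
  refine finprod_eq_prod_of_mulSupport_subset _ fun i hi => ?_
  rw [hfin.coe_toFinset]
  by_contra hiB
  exact hi (hψ _ hiB)

lemma finprod_simpleFunc_comp_eq_prod_pow_encard {ι α : Type*} [MeasurableSpace α] {x : ι → α}
    {B : Set α} (hfin : {i | x i ∈ B}.Finite) {ψ : SimpleFunc α ℝ} (hψ : ∀ a ∉ B, ψ a = 1) :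
    ∏ᶠ i, ψ (x i) =
      ∏ y : ψ.range, (y : ℝ) ^ ({i | x i ∈ B ∩ ψ ⁻¹' {(y : ℝ)}}.encard.toNat) := by
  classical
  rw [finprod_comp_eq_prod_toFinset hfin hψ, Finset.prod_coe_sort ψ.range
    (fun y => y ^ ({i | x i ∈ B ∩ ψ ⁻¹' {y}}.encard.toNat)),
    ← Finset.prod_fiberwise_of_maps_to (t := ψ.range) fun i _ => ψ.mem_range_self (x i)]
  refine Finset.prod_congr rfl fun y _ => ?_
  have hcount : {i | x i ∈ B ∩ ψ ⁻¹' {y}}.encard.toNat =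
      (hfin.toFinset.filter fun i => ψ (x i) = y).card := by
    rw [← Set.ncard_def, ← Set.ncard_coe_finset]
    congr 1
    ext i
    simp
  rw [hcount, ← Finset.prod_const]
  exact Finset.prod_congr rfl fun i hi => (Finset.mem_filter.1 hi).2

lemma integral_one_sub_simpleFunc {α : Type*} [MeasurableSpace α] {ν : Measure α} {B : Set α}
    (hB : MeasurableSet B) (hνB : ν B ≠ ⊤) {ψ : SimpleFunc α ℝ} (hψ : ∀ a ∉ B, ψ a = 1) :
    ∫ a, (1 - ψ a) ∂ν = ∑ y : ψ.range, (ν (B ∩ ψ ⁻¹' {(y : ℝ)})).toReal * (1 - y) := by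
  have hmeas (y : ℝ) : MeasurableSet (B ∩ ψ ⁻¹' {y}) := hB.inter (ψ.measurableSet_fiber y)
  have hsplit (a : α) :
      1 - ψ a = ∑ y ∈ ψ.range, (B ∩ ψ ⁻¹' {y}).indicator (fun _ => 1 - y) a := by
    by_cases ha : a ∈ B
    · rw [Finset.sum_eq_single_of_mem (ψ a) (ψ.mem_range_self a)]
      · rw [Set.indicator_of_mem (show a ∈ B ∩ ψ ⁻¹' {ψ a} from ⟨ha, rfl⟩)]
      · exact fun y _ hy => Set.indicator_of_notMem (fun hmem => hy hmem.2.symm) _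
    · rw [hψ a ha, sub_self, Finset.sum_eq_zero]
      exact fun y _ => Set.indicator_of_notMem (fun hmem => ha hmem.1) _
  simp only [hsplit]
  rw [integral_finsetSum, Finset.sum_coe_sort ψ.range
    fun y => (ν (B ∩ ψ ⁻¹' {y})).toReal * (1 - y)]
  · refine Finset.sum_congr rfl fun y _ => ?_
    rw [integral_indicator_const _ (hmeas y), smul_eq_mul, measureReal_def]
  · exact fun y _ => (integrable_indicator_iff (hmeas y)).2
      (integrableOn_const (hs := measure_ne_top_of_subset Set.inter_subset_left hνB))

lemma IsHPPP.integral_finprod_simpleFunc (h : IsHPPP μ lam X) (hlam : 0 ≤ lam) {B : Set Plane}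
    (hB : MeasurableSet B) (hb : Bornology.IsBounded B) {ψ : SimpleFunc Plane ℝ}
    (hψ : ∀ x ∉ B, ψ x = 1) :
    ∫ ω, ∏ᶠ n, ψ (X n ω) ∂μ = Real.exp (-(lam * ∫ x, (1 - ψ x))) := by
  have hfiber : ∫ ω, ∏ᶠ n, ψ (X n ω) ∂μ =
      ∫ ω, ∏ y : ψ.range, (y : ℝ) ^ ({n | X n ω ∈ B ∩ ψ ⁻¹' {(y : ℝ)}}.encard.toNat) ∂μ := by
    refine integral_congr_ae ?_
    filter_upwards [h.ae_finite hB hb] with ω hω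
    exact finprod_simpleFunc_comp_eq_prod_pow_encard hω hψ
  rw [hfiber, integral_one_sub_simpleFunc hB hb.measure_lt_top.ne hψ]
  refine h.integral_prod_pow_count hlam (ι := ψ.range)
    (A := fun y => B ∩ ψ ⁻¹' {(y : ℝ)}) (fun y => hB.inter (ψ.measurableSet_fiber y))
    (fun y => hb.subset Set.inter_subset_left) (fun y y' hyy' => ?_) _
  refine Disjoint.inter_left' _ (Disjoint.inter_right' _ ?_)
  exact Disjoint.preimage ψ (Set.disjoint_singleton.2 (Subtype.coe_injective.ne hyy'))

lemma exists_simpleFunc_tendsto_of_mem_Icc {α : Type*} [MeasurableSpace α] {φ : α → ℝ}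
    (hφ : Measurable φ) (hφI : ∀ a, φ a ∈ Set.Icc 0 1) {B : Set α} (hB : MeasurableSet B)
    (hφB : ∀ a ∉ B, φ a = 1) :
    ∃ ψ : ℕ → SimpleFunc α ℝ, (∀ j a, ψ j a ∈ Set.Icc 0 1) ∧ (∀ j, ∀ a ∉ B, ψ j a = 1) ∧
      ∀ a, Tendsto (fun j => ψ j a) atTop (𝓝 (φ a)) := by
  have h0 : (0 : ℝ) ∈ Set.Icc 0 1 := Set.left_mem_Icc.2 zero_le_one
  let η := SimpleFunc.approxOn φ hφ (Set.Icc 0 1) 0 h0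
  refine ⟨fun j => SimpleFunc.piecewise B hB (η j) (SimpleFunc.const α 1), fun j a => ?_,
    fun j a ha => by simp [ha], fun a => ?_⟩
  · by_cases ha : a ∈ B
    · simpa [ha] using SimpleFunc.approxOn_mem hφ h0 j a
    · simp [ha]
  · by_cases ha : a ∈ B
    · simpa [ha] using SimpleFunc.tendsto_approxOn hφ h0 (subset_closure (hφI a))
    · simp [ha, hφB a ha]

lemma IsHPPP.integral_finprod (h : IsHPPP μ lam X) (hlam : 0 ≤ lam) {B : Set Plane}
    (hB : MeasurableSet B) (hb : Bornology.IsBounded B) {φ : Plane → ℝ} (hφ : Measurable φ)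
    (hφI : ∀ x, φ x ∈ Set.Icc 0 1) (hφB : ∀ x ∉ B, φ x = 1) :
    ∫ ω, ∏ᶠ n, φ (X n ω) ∂μ = Real.exp (-(lam * ∫ x, (1 - φ x))) := by
  obtain ⟨ψ, hψI, hψB, hψ⟩ := exists_simpleFunc_tendsto_of_mem_Icc hφ hφI hB hφB
  have hlhs : Tendsto (fun j => ∫ ω, ∏ᶠ n, ψ j (X n ω) ∂μ) atTop
      (𝓝 (∫ ω, ∏ᶠ n, φ (X n ω) ∂μ)) := by
    refine tendsto_integral_filter_of_dominated_convergence (fun _ => 1)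
      (Eventually.of_forall fun j => ?_) (Eventually.of_forall fun j => ?_)
      (integrable_const _) ?_
    · have hpow (k : ℝ) : Measurable fun a : ℕ∞ => k ^ a.toNat := Measurable.of_discrete
      refine (Finset.measurable_prod (Finset.univ : Finset (ψ j).range) fun y _ =>
        (hpow y).comp (h.measurable_count (hB.inter
          ((ψ j).measurableSet_fiber y)))).aestronglyMeasurable.congr ?_
      filter_upwards [h.ae_finite hB hb] with ω hω
      exact (finprod_simpleFunc_comp_eq_prod_pow_encard hω (hψB j)).symm
    · filter_upwards [h.ae_finite hB hb] with ω hω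
      rw [finprod_comp_eq_prod_toFinset hω (hψB j),
        Real.norm_of_nonneg (Finset.prod_nonneg fun n _ => (hψI j _).1)]
      exact Finset.prod_le_one (fun n _ => (hψI j _).1) fun n _ => (hψI j _).2
    · filter_upwards [h.ae_finite hB hb] with ω hω
      simp only [finprod_comp_eq_prod_toFinset hω (hψB _), finprod_comp_eq_prod_toFinset hω hφB]
      exact tendsto_finsetProd _ fun n _ => hψ _
  have hrhs : Tendsto (fun j => ∫ x, (1 - ψ j x)) atTop (𝓝 (∫ x, (1 - φ x))) := by
    refine tendsto_integral_of_dominated_convergence (B.indicator fun _ => 1)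
      (fun j => (measurable_const.sub (ψ j).measurable).aestronglyMeasurable)
      ((integrable_indicator_iff hB).2 (integrableOn_const (hs := hb.measure_lt_top.ne)))
      (fun j => Eventually.of_forall fun x => ?_)
      (Eventually.of_forall fun x => (hψ x).const_sub 1)
    by_cases hx : x ∈ B
    · rw [Set.indicator_of_mem hx, Real.norm_of_nonneg (sub_nonneg.2 (hψI j x).2)]
      linarith [(hψI j x).1]
    · simp [hx, hψB j x hx]
  refine tendsto_nhds_unique hlhs ?_
  simp only [fun j => h.integral_finprod_simpleFunc hlam hB hb (hψB j)]
  exact (Real.continuous_exp.tendsto _).comp (hrhs.const_mul lam).neg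

end Poisson

section Grouping

variable {Ω ι κ : Type*} [MeasurableSpace Ω] {μ : Measure Ω}

lemma iIndep_of_indep_biSup [IsProbabilityMeasure μ] {m : ι → MeasurableSpace Ω}
    (h : ∀ (s : Finset ι), ∀ a ∉ s, Indep (⨆ i ∈ s, m i) (m a) μ) : iIndep m μ := by
  classical
  rw [iIndep_iff]
  intro s A hA
  induction s using Finset.induction_on with
  | empty => simp
  | insert a s ha ih =>
    have hs : MeasurableSet[⨆ i ∈ s, m i] (⋂ i ∈ s, A i) :=
      Finset.measurableSet_biInter s fun i hi =>
        le_biSup m hi _ (hA i (Finset.mem_insert_of_mem hi))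
    rw [Finset.set_biInter_insert, Set.inter_comm, Finset.prod_insert ha,
      Indep_iff _ _ μ |>.1 (h s a ha) _ _ hs (hA a (Finset.mem_insert_self a s)),
      ih fun i hi => hA i (Finset.mem_insert_of_mem hi), mul_comm]

lemma iIndep_biSup_of_pairwise_disjoint {m : κ → MeasurableSpace Ω} (hle : ∀ k, m k ≤ ‹_›)
    (hm : iIndep m μ) {S : ι → Set κ} (hS : Pairwise fun i j => Disjoint (S i) (S j)) :
    iIndep (fun i => ⨆ k ∈ S i, m k) μ := by
  have := hm.isProbabilityMeasure
  refine iIndep_of_indep_biSup fun s a ha => ?_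
  have hdisj : Disjoint (⋃ i ∈ s, S i) (S a) :=
    Set.disjoint_iUnion₂_left.2 fun i hi => hS (ne_of_mem_of_not_mem hi ha)
  refine indep_of_indep_of_le_left (indep_iSup_of_disjoint hle hm hdisj) ?_
  exact iSup₂_le fun i hi => biSup_mono fun k hk => Set.mem_biUnion hi hk

end Grouping

section Marking

variable {Ω E K : Type*} [MeasurableSpace Ω] [MeasurableSpace E] [MeasurableSpace K]
  {μ : Measure Ω} [IsProbabilityMeasure μ]

lemma integral_mem_Icc_zero_one {g : Ω → ℝ} (hg : ∀ x, g x ∈ Set.Icc 0 1) :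
    ∫ x, g x ∂μ ∈ Set.Icc 0 1 := by
  refine ⟨integral_nonneg fun x => (hg x).1, ?_⟩
  simpa using integral_mono_of_nonneg (μ := μ) (Eventually.of_forall fun x => (hg x).1)
    (integrable_const (1 : ℝ)) (Eventually.of_forall fun x => (hg x).2)

lemma integral_prod_marked {ι : Type*} [Fintype ι] {X : ι → Ω → E} {Z : ι → Ω → K}
    (hX : ∀ i, Measurable (X i)) (hZ : ∀ i, Measurable (Z i))
    (hXZ : IndepFun (fun ω i => X i ω) (fun ω i => Z i ω) μ) (hZi : iIndepFun Z μ)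
    {ν : Measure K} [IsProbabilityMeasure ν] (hν : ∀ i, μ.map (Z i) = ν) {Φ : E → K → ℝ}
    (hΦ : Measurable (Function.uncurry Φ)) (hΦI : ∀ x z, Φ x z ∈ Set.Icc 0 1) :
    ∫ ω, ∏ i, Φ (X i ω) (Z i ω) ∂μ = ∫ ω, ∏ i, ∫ z, Φ (X i ω) z ∂ν ∂μ := by
  have hXm : Measurable fun ω i => X i ω := measurable_pi_lambda _ hX
  have hZm : Measurable fun ω i => Z i ω := measurable_pi_lambda _ hZ
  have hjoint : μ.map (fun ω => ((fun i => X i ω), fun i => Z i ω)) =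
      (μ.map fun ω i => X i ω).prod (Measure.pi fun _ => ν) := by
    rw [(indepFun_iff_map_prod_eq_prod_map_map hXm.aemeasurable hZm.aemeasurable).1 hXZ,
      hZi.map_fun_eq_pi_map fun i => (hZ i).aemeasurable]
    simp only [hν]
  have hprodm : Measurable fun y : (ι → E) × (ι → K) => ∏ i, Φ (y.1 i) (y.2 i) :=
    Finset.measurable_prod _ fun i _ => hΦ.comp
      (f := fun y : (ι → E) × (ι → K) => (y.1 i, y.2 i)) (by fun_prop)
  have hmeanm : Measurable fun x : ι → E => ∏ i, ∫ z, Φ (x i) z ∂ν :=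
    Finset.measurable_prod _ fun i _ =>
      hΦ.stronglyMeasurable.integral_prod_right.measurable.comp (measurable_pi_apply i)
  have : IsProbabilityMeasure (μ.map fun ω i => X i ω) :=
    Measure.isProbabilityMeasure_map hXm.aemeasurable
  calc ∫ ω, ∏ i, Φ (X i ω) (Z i ω) ∂μ
      = ∫ y, ∏ i, Φ (y.1 i) (y.2 i) ∂((μ.map fun ω i => X i ω).prod (Measure.pi fun _ => ν)) := by
        rw [← hjoint, integral_map (hXm.prodMk hZm).aemeasurable hprodm.aestronglyMeasurable]
    _ = ∫ x, ∫ z, ∏ i, Φ (x i) (z i) ∂(Measure.pi fun _ => ν) ∂(μ.map fun ω i => X i ω) :=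
        integral_prod _ (.of_mem_Icc 0 1 hprodm.aemeasurable
          (ae_of_all _ fun y => unitInterval.prod_mem fun i _ => hΦI _ _))
    _ = ∫ x, ∏ i, ∫ z, Φ (x i) z ∂ν ∂(μ.map fun ω i => X i ω) := by
        simp only [fun x : ι → E =>
          integral_fintype_prod_eq_prod (μ := fun _ => ν) fun i => Φ (x i)]
    _ = _ := integral_map hXm.aemeasurable hmeanm.aestronglyMeasurable

lemma tendsto_prod_range_finprod {g : ℕ → ℝ} (hg : (Function.mulSupport g).Finite) :
    Tendsto (fun M => ∏ n ∈ Finset.range M, g n) atTop (𝓝 (∏ᶠ n, g n)) := by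
  obtain ⟨m, hm⟩ := hg.bddAbove
  refine tendsto_const_nhds.congr' ?_
  filter_upwards [eventually_gt_atTop m] with M hM
  refine finprod_eq_prod_of_mulSupport_subset _ fun n hn => ?_
  simpa using (hm hn).trans_lt hM

lemma tendsto_integral_prod_range_finprod {g : ℕ → Ω → ℝ} (hg : ∀ n, Measurable (g n))
    (hgI : ∀ n ω, g n ω ∈ Set.Icc 0 1)
    (hfin : ∀ᵐ ω ∂μ, (Function.mulSupport fun n => g n ω).Finite) :
    Tendsto (fun M => ∫ ω, ∏ n ∈ Finset.range M, g n ω ∂μ) atTop (𝓝 (∫ ω, ∏ᶠ n, g n ω ∂μ)) := by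
  refine tendsto_integral_of_dominated_convergence (fun _ => 1)
    (fun M => (Finset.measurable_prod _ fun n _ => hg n).aestronglyMeasurable)
    (integrable_const _) (fun M => ae_of_all _ fun ω => ?_)
    (hfin.mono fun ω => tendsto_prod_range_finprod)
  have hI := unitInterval.prod_mem (t := Finset.range M) fun n _ => hgI n ω
  rw [Real.norm_of_nonneg hI.1]
  exact hI.2

lemma integral_finprod_marked {X : ℕ → Ω → E} {Z : ℕ → Ω → K} (hX : ∀ n, Measurable (X n))
    (hZ : ∀ n, Measurable (Z n)) (hXZ : IndepFun (fun ω n => X n ω) (fun ω n => Z n ω) μ)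
    (hZi : iIndepFun Z μ) {ν : Measure K} [IsProbabilityMeasure ν] (hν : ∀ n, μ.map (Z n) = ν)
    {Φ : E → K → ℝ} (hΦ : Measurable (Function.uncurry Φ)) (hΦI : ∀ x z, Φ x z ∈ Set.Icc 0 1)
    {B : Set E} (hB : ∀ x ∉ B, ∀ z, Φ x z = 1) (hfin : ∀ᵐ ω ∂μ, {n | X n ω ∈ B}.Finite) :
    ∫ ω, ∏ᶠ n, Φ (X n ω) (Z n ω) ∂μ = ∫ ω, ∏ᶠ n, ∫ z, Φ (X n ω) z ∂ν ∂μ := by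
  have hmean : Measurable fun x => ∫ z, Φ x z ∂ν :=
    hΦ.stronglyMeasurable.integral_prod_right.measurable
  have hsupp {g : ℕ → Ω → ℝ} (hg : ∀ n ω, X n ω ∉ B → g n ω = 1) :
      ∀ᵐ ω ∂μ, (Function.mulSupport fun n => g n ω).Finite :=
    hfin.mono fun ω hω => hω.subset fun n hn => not_not.1 fun hnB => hn (hg n ω hnB)
  refine tendsto_nhds_unique
    (tendsto_integral_prod_range_finprod (fun n => hΦ.comp ((hX n).prodMk (hZ n)))
      (fun n ω => hΦI _ _) (hsupp fun n ω hn => hB _ hn _)) ?_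
  refine (tendsto_integral_prod_range_finprod (fun n => hmean.comp (hX n))
    (fun n ω => integral_mem_Icc_zero_one (hΦI _))
    (hsupp fun n ω hn => by simp [hB _ hn])).congr fun M => ?_
  have hXZM : IndepFun (fun ω (i : Fin M) => X i ω) (fun ω (i : Fin M) => Z i ω) μ :=
    hXZ.comp (φ := fun (x : ℕ → E) (i : Fin M) => x i) (ψ := fun (z : ℕ → K) (i : Fin M) => z i)
      (by fun_prop) (by fun_prop)
  simpa only [Finset.prod_range, Function.comp_apply] using
    (integral_prod_marked (fun i : Fin M => hX i) (fun i => hZ i) hXZM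
      (hZi.precomp Fin.val_injective) (fun i => hν i) hΦ hΦI).symm

end Marking

/-- The mark of the `n`-th BS relevant to the file `f`: whether it stores `f`, its fading power
and its angle. -/
def PicoTier.mark {Ω : Type*} {Nc : ℕ} (T : PicoTier Ω Nc) (f : Fin Nc) (n : ℕ) (ω : Ω) :
    Prop × ℝ × ℝ :=
  (f ∈ T.cache n ω, T.fading n ω, T.angle n ω)

section MarkLaw

variable {Nc : ℕ}

/-- The joint law of the fading power and the angle of a BS. -/
def channelLaw (Q : Params Nc) : Measure (ℝ × ℝ) :=
  (gammaMeasure (Q.Nnak : ℝ) (Q.Nnak : ℝ)).prod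
    (cond volume (Set.Icc (-(Q.d / Q.wl)) (Q.d / Q.wl)))

/-- The law of the mark of a BS: storing `f` is a Bernoulli event independent of the channel. -/
def markLaw (Q : Params Nc) (f : Fin Nc) : Measure (Prop × ℝ × ℝ) :=
  (ENNReal.ofReal (Q.p f) • Measure.dirac True +
    ENNReal.ofReal (1 - Q.p f) • Measure.dirac False).prod (channelLaw Q)

variable (Q : Params Nc) (f : Fin Nc)

instance isProbabilityMeasure_gammaMeasure_Nnak :
    IsProbabilityMeasure (gammaMeasure (Q.Nnak : ℝ) (Q.Nnak : ℝ)) :=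
  isProbabilityMeasure_gammaMeasure (Nat.cast_pos.2 Q.Nnak_pos) (Nat.cast_pos.2 Q.Nnak_pos)

instance isProbabilityMeasure_cond_angle :
    IsProbabilityMeasure (cond (volume : Measure ℝ) (Set.Icc (-(Q.d / Q.wl)) (Q.d / Q.wl))) := by
  have hd : 0 < Q.d / Q.wl := div_pos Q.d_pos Q.wl_pos
  refine cond_isProbabilityMeasure_of_finite ?_ measure_Icc_lt_top.ne
  simp only [Real.volume_Icc, ne_eq, ENNReal.ofReal_eq_zero, not_le]
  linarith

instance isProbabilityMeasure_channelLaw : IsProbabilityMeasure (channelLaw Q) := by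
  unfold channelLaw
  infer_instance

instance isProbabilityMeasure_markLaw : IsProbabilityMeasure (markLaw Q f) := by
  have : IsProbabilityMeasure (ENNReal.ofReal (Q.p f) • Measure.dirac True +
      ENNReal.ofReal (1 - Q.p f) • Measure.dirac False : Measure Prop) := ⟨by
    simp [← ENNReal.ofReal_add (Q.p_nonneg f) (sub_nonneg.2 (Q.p_le_one f))]⟩
  unfold markLaw
  infer_instance

lemma integral_markLaw {F : Prop × ℝ × ℝ → ℝ} (hF : Integrable F (markLaw Q f)) :
    ∫ z, F z ∂(markLaw Q f) = Q.p f * ∫ z, F (True, z) ∂(channelLaw Q) +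
      (1 - Q.p f) * ∫ z, F (False, z) ∂(channelLaw Q) := by
  rw [markLaw, integral_prod _ hF, integral_add_measure
      ((integrable_dirac (by simp)).smul_measure ENNReal.ofReal_ne_top)
      ((integrable_dirac (by simp)).smul_measure ENNReal.ofReal_ne_top)]
  simp [ENNReal.toReal_ofReal, Q.p_nonneg, Q.p_le_one]

end MarkLaw

section SourceMeasurability

variable {Ω : Type*} {Nc : ℕ} {T : PicoTier Ω Nc} {m : MeasurableSpace Ω}

lemma PicoTier.measurable_locs_of_le (h : T.sigma .locations ≤ m) :
    Measurable fun ω n => T.loc n ω := by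
  refine measurable_pi_lambda _ fun n => (comap_measurable (T.loc n)).mono ?_ le_rfl
  exact (le_iSup (fun n => MeasurableSpace.comap (T.loc n) inferInstance) n).trans h

lemma PicoTier.measurable_cache_of_le (f : Fin Nc) {n : ℕ} (h : T.sigma (.cache n) ≤ m) :
    Measurable fun ω => f ∈ T.cache n ω :=
  (measurable_set_mem f).comp ((comap_measurable (T.cache n)).mono h le_rfl)

lemma PicoTier.measurable_channel_of_le {n : ℕ} (hf : T.sigma (.fading n) ≤ m)
    (ha : T.sigma (.angle n) ≤ m) : Measurable fun ω => (T.fading n ω, T.angle n ω) :=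
  ((comap_measurable (T.fading n)).mono hf le_rfl).prodMk
    ((comap_measurable (T.angle n)).mono ha le_rfl)

lemma PicoTier.measurable_mark_of_le (f : Fin Nc) {n : ℕ} (hc : T.sigma (.cache n) ≤ m)
    (hf : T.sigma (.fading n) ≤ m) (ha : T.sigma (.angle n) ≤ m) : Measurable (T.mark f n) :=
  (measurable_cache_of_le f hc).prodMk (measurable_channel_of_le hf ha)

lemma PicoTier.measurable_marks_of_le (f : Fin Nc) (h : ∀ i ≠ Source.locations, T.sigma i ≤ m) :
    Measurable fun ω n => T.mark f n ω :=
  measurable_pi_lambda _ fun _ => measurable_mark_of_le f (h _ (by simp)) (h _ (by simp))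
    (h _ (by simp))

end SourceMeasurability

section Tier

variable {Ω : Type*} [MeasurableSpace Ω] {μ : Measure Ω} {Nc : ℕ} {Q : Params Nc}
  {T : PicoTier Ω Nc}

lemma map_prop_eq {q : Ω → Prop} (hq : Measurable q) :
    μ.map q = μ {ω | q ω} • Measure.dirac True + μ {ω | ¬ q ω} • Measure.dirac False := by
  refine Measure.ext_of_singleton fun a => ?_
  rw [Measure.map_apply hq (measurableSet_singleton a)]
  by_cases ha : a <;> simp [ha, Set.preimage]

lemma IsPicoTier.sigma_le (hT : IsPicoTier μ Q T) (i : Source) : T.sigma i ≤ ‹_› := by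
  cases i with
  | locations => exact iSup_le fun n => (hT.hppp.measurable n).comap_le
  | cache n => exact (hT.cache_measurable n).comap_le
  | fading n => exact (hT.fading_measurable n).comap_le
  | angle n => exact (hT.angle_measurable n).comap_le

lemma IsPicoTier.measurable_mark (hT : IsPicoTier μ Q T) (f : Fin Nc) (n : ℕ) :
    Measurable (T.mark f n) :=
  PicoTier.measurable_mark_of_le f (hT.sigma_le _) (hT.sigma_le _) (hT.sigma_le _)

lemma IsPicoTier.indepFun_of_disjoint {β γ : Type*} [MeasurableSpace β] [MeasurableSpace γ]
    (hT : IsPicoTier μ Q T) {S S' : Set Source} (hS : Disjoint S S') {g : Ω → β} {g' : Ω → γ}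
    (hg : Measurable[⨆ i ∈ S, T.sigma i] g) (hg' : Measurable[⨆ i ∈ S', T.sigma i] g') :
    IndepFun g g' μ := by
  rw [IndepFun_iff_Indep]
  exact indep_of_indep_of_le_left (indep_of_indep_of_le_right
    (indep_iSup_of_disjoint hT.sigma_le hT.indep hS) hg'.comap_le) hg.comap_le

lemma IsPicoTier.indepFun_loc_mark (hT : IsPicoTier μ Q T) (f : Fin Nc) :
    IndepFun (fun ω n => T.loc n ω) (fun ω n => T.mark f n ω) μ :=
  hT.indepFun_of_disjoint (S := {.locations}) disjoint_compl_right
    (PicoTier.measurable_locs_of_le (le_biSup T.sigma (Set.mem_singleton _)))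
    (PicoTier.measurable_marks_of_le f fun _ hi => le_biSup T.sigma hi)

lemma IsPicoTier.indepFun_cache_channel (hT : IsPicoTier μ Q T) (f : Fin Nc) (n : ℕ) :
    IndepFun (fun ω => f ∈ T.cache n ω) (fun ω => (T.fading n ω, T.angle n ω)) μ :=
  hT.indepFun_of_disjoint (S := {.cache n}) (S' := {.fading n, .angle n}) (by simp)
    (PicoTier.measurable_cache_of_le f (le_biSup T.sigma (by simp)))
    (PicoTier.measurable_channel_of_le (le_biSup T.sigma (by simp)) (le_biSup T.sigma (by simp)))

lemma IsPicoTier.iIndepFun_mark (hT : IsPicoTier μ Q T) (f : Fin Nc) :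
    iIndepFun (T.mark f) μ := by
  refine iIndep_of_iIndep_of_le (iIndep_biSup_of_pairwise_disjoint hT.sigma_le hT.indep
    (S := fun n => {.cache n, .fading n, .angle n}) fun i j hij => ?_) fun n =>
      Measurable.comap_le (PicoTier.measurable_mark_of_le f ?_ ?_ ?_)
  · simp [hij.symm]
  all_goals exact le_biSup T.sigma (by simp)

lemma IsPicoTier.map_channel [IsProbabilityMeasure μ] (hT : IsPicoTier μ Q T) (n : ℕ) :
    μ.map (fun ω => (T.fading n ω, T.angle n ω)) = channelLaw Q := by
  have hind : IndepFun (T.fading n) (T.angle n) μ := by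
    rw [IndepFun_iff_Indep]
    exact hT.indep.indep (i := .fading n) (j := .angle n) (by simp)
  rw [(indepFun_iff_map_prod_eq_prod_map_map (hT.fading_measurable n).aemeasurable
    (hT.angle_measurable n).aemeasurable).1 hind, hT.fading_law n, channelLaw,
    show μ.map (T.angle n) = _ from hT.angle_law n]

lemma IsPicoTier.map_mark [IsProbabilityMeasure μ] (hT : IsPicoTier μ Q T) (f : Fin Nc) (n : ℕ) :
    μ.map (T.mark f n) = markLaw Q f := by
  have hcache : Measurable fun ω => f ∈ T.cache n ω := (hT.measurable_mark f n).fst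
  have hchannel : Measurable fun ω => (T.fading n ω, T.angle n ω) := (hT.measurable_mark f n).snd
  have hlaw : μ.map (fun ω => f ∈ T.cache n ω) = ENNReal.ofReal (Q.p f) • Measure.dirac True +
      ENNReal.ofReal (1 - Q.p f) • Measure.dirac False := by
    rw [map_prop_eq hcache, hT.cache_law n f, ← Set.compl_ofPred, prob_compl_eq_one_sub
      (measurableSet_setOfPred.2 hcache), hT.cache_law n f, ENNReal.ofReal_sub _ (Q.p_nonneg f),
      ENNReal.ofReal_one]
  change μ.map (fun ω => (f ∈ T.cache n ω, (T.fading n ω, T.angle n ω))) = _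
  rw [(indepFun_iff_map_prod_eq_prod_map_map hcache.aemeasurable hchannel.aemeasurable).1
    (hT.indepFun_cache_channel f n), hlaw, hT.map_channel n, markLaw]

end Tier

section Attenuation

lemma exp_neg_mul_mem_Icc {κ u : ℝ} (hκ : 0 ≤ κ) (hu : 0 ≤ u) :
    Real.exp (-(κ * u)) ∈ Set.Icc 0 1 :=
  ⟨(Real.exp_pos _).le, Real.exp_le_one_iff.2 (neg_nonpos.2 (mul_nonneg hκ hu))⟩

variable {Nc : ℕ} (Q : Params Nc)

lemma measurable_pathLoss : Measurable (pathLoss Q) := by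
  unfold pathLoss
  exact Measurable.ite (measurableSet_le measurable_const (by fun_prop)) (by fun_prop)
    measurable_const

lemma pathLoss_nonneg {v : ℝ} (hv : 0 ≤ v) : 0 ≤ pathLoss Q v := by
  have := Q.C_pos
  unfold pathLoss
  split_ifs <;> positivity

lemma pathLoss_of_lt {v : ℝ} (hv : Q.RL < v) : pathLoss Q v = 0 := by
  rw [pathLoss, if_neg (by linarith)]

/-- Power received from a BS at `x` with fading power `|z.1|` and angle `z.2`; the absolute value,
which is harmless as the fading is a.s. nonnegative, makes it nonnegative everywhere. -/
def rxPower (x : Plane) (z : ℝ × ℝ) : ℝ :=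
  Q.P * pathLoss Q ‖x‖ * (Q.Nant * |z.1| * arrayGain Q.Nant z.2)

lemma rxPower_nonneg (x : Plane) (z : ℝ × ℝ) : 0 ≤ rxPower Q x z :=
  mul_nonneg (mul_nonneg Q.P_pos.le (pathLoss_nonneg Q (norm_nonneg x)))
    (mul_nonneg (by positivity) (arrayGain_nonneg Q.Nant z.2))

lemma rxPower_of_lt {x : Plane} (hx : Q.RL < ‖x‖) (z : ℝ × ℝ) : rxPower Q x z = 0 := by
  rw [rxPower, pathLoss_of_lt Q hx, mul_zero, zero_mul]

lemma measurable_rxPower : Measurable (Function.uncurry (rxPower Q)) := by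
  have := measurable_pathLoss Q
  have := (continuous_arrayGain Q.Nant_pos).measurable
  unfold rxPower
  fun_prop

/-- Laplace factor of a single interferer. -/
def attn (κ : ℝ) (x : Plane) (z : ℝ × ℝ) : ℝ := Real.exp (-(κ * rxPower Q x z))

lemma attn_mem_Icc {κ : ℝ} (hκ : 0 ≤ κ) (x : Plane) (z : ℝ × ℝ) :
    attn Q κ x z ∈ Set.Icc 0 1 :=
  exp_neg_mul_mem_Icc hκ (rxPower_nonneg Q x z)

lemma attn_of_lt (κ : ℝ) {x : Plane} (hx : Q.RL < ‖x‖) (z : ℝ × ℝ) : attn Q κ x z = 1 := by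
  simp [attn, rxPower_of_lt Q hx]

lemma measurable_attn (κ : ℝ) : Measurable (Function.uncurry (attn Q κ)) :=
  Real.measurable_exp.comp ((measurable_rxPower Q).const_mul κ).neg

/-- Laplace factor of a single interferer at `x`, averaged over the channel. -/
def meanAttn (κ : ℝ) (x : Plane) : ℝ := ∫ z, attn Q κ x z ∂(channelLaw Q)

lemma measurable_meanAttn (κ : ℝ) : Measurable (meanAttn Q κ) :=
  (measurable_attn Q κ).stronglyMeasurable.integral_prod_right.measurable

lemma meanAttn_mem_Icc {κ : ℝ} (hκ : 0 ≤ κ) (x : Plane) : meanAttn Q κ x ∈ Set.Icc 0 1 :=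
  integral_mem_Icc_zero_one (attn_mem_Icc Q hκ x)

lemma meanAttn_of_lt (κ : ℝ) {x : Plane} (hx : Q.RL < ‖x‖) : meanAttn Q κ x = 1 := by
  simp [meanAttn, attn_of_lt Q κ hx]

end Attenuation

section Background

variable {Nc : ℕ} (Q : Params Nc) (f : Fin Nc)

/-- Probability that a BS at distance `v` belongs to the background of radius `b`, which consists
of all BSs but those storing `f` within distance `b` of the user. -/
def backgroundProb (b v : ℝ) : ℝ := if v ≤ b then 1 - Q.p f else 1

lemma backgroundProb_mem_Icc (b v : ℝ) : backgroundProb Q f b v ∈ Set.Icc 0 1 := by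
  have := Q.p_nonneg f
  have := Q.p_le_one f
  unfold backgroundProb
  split_ifs <;> constructor <;> linarith

lemma measurable_backgroundProb (b : ℝ) : Measurable (backgroundProb Q f b) :=
  Measurable.ite measurableSet_Iic measurable_const measurable_const

/-- Exponent of the Laplace transform of the power received from the background of radius `b`, per
unit density. -/
def interfExponent (κ b : ℝ) : ℝ :=
  ∫ x : Plane, backgroundProb Q f b ‖x‖ * (1 - meanAttn Q κ x)

lemma integrable_indicator_closedBall (r : ℝ) :
    Integrable ((Metric.closedBall (0 : Plane) r).indicator (1 : Plane → ℝ)) :=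
  (integrable_indicator_iff measurableSet_closedBall).2
    (integrableOn_const (hs := Metric.isBounded_closedBall.measure_lt_top.ne))

lemma norm_interfExponent_integrand_le {κ : ℝ} (hκ : 0 ≤ κ) (b : ℝ) (x : Plane) :
    ‖backgroundProb Q f b ‖x‖ * (1 - meanAttn Q κ x)‖ ≤
      (Metric.closedBall (0 : Plane) Q.RL).indicator 1 x := by
  by_cases hx : x ∈ Metric.closedBall 0 Q.RL
  · have hI := unitInterval.mul_mem (backgroundProb_mem_Icc Q f b ‖x‖)
      (Set.Icc.one_sub_mem (meanAttn_mem_Icc Q hκ x))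
    rw [Set.indicator_of_mem hx, Real.norm_of_nonneg hI.1]
    exact hI.2
  · rw [meanAttn_of_lt Q κ (by simpa using hx), Set.indicator_of_notMem hx]
    simp

lemma integrable_interfExponent {κ : ℝ} (hκ : 0 ≤ κ) (b : ℝ) :
    Integrable fun x : Plane => backgroundProb Q f b ‖x‖ * (1 - meanAttn Q κ x) :=
  (integrable_indicator_closedBall Q.RL).mono'
    (((measurable_backgroundProb Q f b).comp measurable_norm).mul
      (measurable_const.sub (measurable_meanAttn Q κ))).aestronglyMeasurable
    (ae_of_all _ (norm_interfExponent_integrand_le Q f hκ b))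

open Classical in
/-- Factor of a BS in the functional `1{no BS storing f within a} exp(-κ U)`, where `U` is the
power received from the background of radius `b`. -/
def thinFactor (κ a b : ℝ) (x : Plane) (m : Prop × ℝ × ℝ) : ℝ :=
  if m.1 then (if ‖x‖ ≤ a then 0 else if ‖x‖ ≤ b then 1 else attn Q κ x m.2)
  else attn Q κ x m.2

lemma measurable_thinFactor (κ a b : ℝ) : Measurable (Function.uncurry (thinFactor Q κ a b)) := by
  have hattn : Measurable fun y : Plane × Prop × ℝ × ℝ => attn Q κ y.1 y.2.2 :=
    (measurable_attn Q κ).comp (f := fun y : Plane × Prop × ℝ × ℝ => (y.1, y.2.2)) (by fun_prop)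
  have hnorm (c : ℝ) : MeasurableSet {y : Plane × Prop × ℝ × ℝ | ‖y.1‖ ≤ c} :=
    measurableSet_le (by fun_prop) measurable_const
  have hstores : MeasurableSet {y : Plane × Prop × ℝ × ℝ | y.2.1} :=
    measurableSet_setOfPred.2 (by fun_prop)
  exact Measurable.ite hstores (Measurable.ite (hnorm a) measurable_const
    (Measurable.ite (hnorm b) measurable_const hattn)) hattn

lemma thinFactor_mem_Icc {κ : ℝ} (hκ : 0 ≤ κ) (a b : ℝ) (x : Plane) (m : Prop × ℝ × ℝ) :
    thinFactor Q κ a b x m ∈ Set.Icc 0 1 := by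
  have := attn_mem_Icc Q hκ x m.2
  unfold thinFactor
  split_ifs <;> simp_all

lemma thinFactor_of_lt (κ : ℝ) {a b : ℝ} {x : Plane} (hx : max Q.RL a < ‖x‖)
    (m : Prop × ℝ × ℝ) : thinFactor Q κ a b x m = 1 := by
  have := attn_of_lt Q κ ((le_max_left _ _).trans_lt hx) m.2
  have := (le_max_right _ _).trans_lt hx
  unfold thinFactor
  split_ifs <;> first | rfl | assumption | linarith

lemma one_sub_integral_thinFactor {κ a b : ℝ} (hκ : 0 ≤ κ) (hab : a ≤ b) (x : Plane) :
    1 - ∫ m, thinFactor Q κ a b x m ∂(markLaw Q f) =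
      Q.p f * (Metric.closedBall 0 a).indicator 1 x +
        backgroundProb Q f b ‖x‖ * (1 - meanAttn Q κ x) := by
  classical
  have hint : Integrable (thinFactor Q κ a b x) (markLaw Q f) := .of_mem_Icc 0 1
    ((measurable_thinFactor Q κ a b).comp measurable_prodMk_left).aemeasurable
    (ae_of_all _ fun m => thinFactor_mem_Icc Q hκ a b x m)
  rw [integral_markLaw Q f hint]
  simp only [thinFactor, backgroundProb, meanAttn, Set.indicator_apply, mem_closedBall_zero_iff,
    Pi.one_apply, if_true, if_false]
  split_ifs <;> first | (exfalso; linarith) | (simp; ring)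

lemma volume_real_closedBall {r : ℝ} (hr : 0 ≤ r) :
    volume.real (Metric.closedBall (0 : Plane) r) = Real.pi * r ^ 2 := by
  rw [measureReal_def, EuclideanSpace.volume_closedBall_fin_two, ENNReal.toReal_mul,
    ENNReal.toReal_pow, ENNReal.toReal_ofReal hr, ENNReal.toReal_ofReal Real.pi_pos.le, mul_comm]

lemma integral_one_sub_integral_thinFactor {κ a b : ℝ} (hκ : 0 ≤ κ) (ha : 0 ≤ a) (hab : a ≤ b) :
    ∫ x, (1 - ∫ m, thinFactor Q κ a b x m ∂(markLaw Q f)) =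
      Q.p f * (Real.pi * a ^ 2) + interfExponent Q f κ b := by
  simp only [one_sub_integral_thinFactor Q f hκ hab]
  rw [integral_add ((integrable_indicator_closedBall a).const_mul _)
    (integrable_interfExponent Q f hκ b), integral_const_mul,
    integral_indicator_one measurableSet_closedBall, volume_real_closedBall ha, interfExponent]

variable {Q} {Ω : Type*} [MeasurableSpace Ω] {μ : Measure Ω} [IsProbabilityMeasure μ]
  {T : PicoTier Ω Nc}

lemma IsPicoTier.integral_finprod_thinFactor (hT : IsPicoTier μ Q T) {κ a b : ℝ}
    (hκ : 0 ≤ κ) (ha : 0 ≤ a) (hab : a ≤ b) :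
    ∫ ω, ∏ᶠ n, thinFactor Q κ a b (T.loc n ω) (T.mark f n ω) ∂μ =
      Real.exp (-(Q.lam * (Q.p f * (Real.pi * a ^ 2) + interfExponent Q f κ b))) := by
  have hfar (x) (hx : x ∉ Metric.closedBall (0 : Plane) (max Q.RL a)) (m) :
      thinFactor Q κ a b x m = 1 := thinFactor_of_lt Q κ (by simpa using hx) m
  rw [integral_finprod_marked hT.hppp.measurable (hT.measurable_mark f) (hT.indepFun_loc_mark f)
      (hT.iIndepFun_mark f) (hT.map_mark f) (measurable_thinFactor Q κ a b)
      (thinFactor_mem_Icc Q hκ a b) hfar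
      (hT.hppp.ae_finite measurableSet_closedBall Metric.isBounded_closedBall),
    hT.hppp.integral_finprod Q.lam_pos.le
      (measurableSet_closedBall (x := 0) (ε := max Q.RL a)) Metric.isBounded_closedBall
      (measurable_thinFactor Q κ a b).stronglyMeasurable.integral_prod_right.measurable
      (fun x => integral_mem_Icc_zero_one (thinFactor_mem_Icc Q hκ a b x))
      (fun x hx => by simp [hfar x hx]),
    integral_one_sub_integral_thinFactor Q f hκ ha hab]

end Background

section Pathwise

variable {Ω : Type*} {Nc : ℕ} {Q : Params Nc} {T : PicoTier Ω Nc} {f : Fin Nc} {ω : Ω}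

/-- A configuration with finitely many BSs in each disc and nonnegative fading powers. -/
def PicoTier.IsRegular (T : PicoTier Ω Nc) (ω : Ω) : Prop :=
  (∀ k : ℕ, {n | ‖T.loc n ω‖ ≤ k}.Finite) ∧ ∀ n, 0 ≤ T.fading n ω

/-- No BS within distance `t` of the user stores `f`. -/
def PicoTier.NoneWithin (T : PicoTier Ω Nc) (f : Fin Nc) (t : ℝ) (ω : Ω) : Prop :=
  ∀ n, f ∈ T.cache n ω → t < ‖T.loc n ω‖

/-- Power received from the `n`-th BS. -/
def PicoTier.rx (T : PicoTier Ω Nc) (Q : Params Nc) (n : ℕ) (ω : Ω) : ℝ :=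
  rxPower Q (T.loc n ω) (T.fading n ω, T.angle n ω)

open Classical in
/-- Power received from the background of radius `b`: from all BSs but those storing `f` within
distance `b` of the user. -/
def PicoTier.background (T : PicoTier Ω Nc) (Q : Params Nc) (f : Fin Nc) (b : ℝ) (ω : Ω) : ℝ :=
  ∑' n, if f ∈ T.cache n ω ∧ ‖T.loc n ω‖ ≤ b then 0 else T.rx Q n ω

lemma PicoTier.not_noneWithin {t : ℝ} :
    ¬ T.NoneWithin f t ω ↔ ∃ n, f ∈ T.cache n ω ∧ ‖T.loc n ω‖ ≤ t := by
  simp [PicoTier.NoneWithin]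

lemma PicoTier.tsum_ite_rx_nonneg (p : ℕ → Prop) [DecidablePred p] :
    0 ≤ ∑' n, if p n then 0 else T.rx Q n ω :=
  tsum_nonneg fun n => by
    split_ifs
    · exact le_rfl
    · exact rxPower_nonneg Q _ _

lemma PicoTier.background_nonneg (b : ℝ) : 0 ≤ T.background Q f b ω := by
  classical exact tsum_ite_rx_nonneg _

open Classical in
lemma PicoTier.IsRegular.interference_eq (h : T.IsRegular ω) :
    T.interference Q f ω = ∑' n, if T.IsServing f n ω then 0 else T.rx Q n ω := by
  simp only [PicoTier.interference, PicoTier.rx, rxPower, abs_of_nonneg (h.2 _)]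

lemma PicoTier.IsRegular.interference_nonneg (h : T.IsRegular ω) : 0 ≤ T.interference Q f ω := by
  classical
  rw [h.interference_eq]
  exact tsum_ite_rx_nonneg _

lemma PicoTier.IsRegular.exists_finset (h : T.IsRegular ω) (t : ℝ) :
    ∃ S : Finset ℕ, ∀ n ∉ S, t < ‖T.loc n ω‖ := by
  obtain ⟨k, hk⟩ := exists_nat_ge t
  refine ⟨(h.1 k).toFinset, fun n hn => ?_⟩
  simp only [Set.Finite.mem_toFinset, Set.mem_ofPred_eq, not_le] at hn
  exact hk.trans_lt hn

open Classical in
lemma PicoTier.IsRegular.exp_neg_background (h : T.IsRegular ω) (κ b : ℝ) :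
    Real.exp (-(κ * T.background Q f b ω)) =
      ∏ᶠ n, if f ∈ T.cache n ω ∧ ‖T.loc n ω‖ ≤ b then 1
        else attn Q κ (T.loc n ω) (T.fading n ω, T.angle n ω) := by
  obtain ⟨S, hS⟩ := h.exists_finset Q.RL
  have hsum : T.background Q f b ω =
      ∑ n ∈ S, if f ∈ T.cache n ω ∧ ‖T.loc n ω‖ ≤ b then 0 else T.rx Q n ω :=
    tsum_eq_sum fun n hn => by rw [PicoTier.rx, rxPower_of_lt Q (hS n hn), ite_self]
  rw [hsum, finprod_eq_prod_of_mulSupport_subset (s := S) _ fun n hn => by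
      by_contra hnS
      exact hn (by simp only [attn_of_lt Q κ (hS n hnS), ite_self]),
    Finset.mul_sum, ← Finset.sum_neg_distrib, Real.exp_sum]
  refine Finset.prod_congr rfl fun n _ => ?_
  split_ifs
  · simp
  · rfl

lemma PicoTier.IsRegular.finprod_thinFactor (h : T.IsRegular ω) (κ a b : ℝ)
    [Decidable (T.NoneWithin f a ω)] :
    ∏ᶠ n, thinFactor Q κ a b (T.loc n ω) (T.mark f n ω) =
      if T.NoneWithin f a ω then Real.exp (-(κ * T.background Q f b ω)) else 0 := by
  classical
  split_ifs with hnone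
  · rw [h.exp_neg_background]
    refine finprod_congr fun n => ?_
    by_cases hc : f ∈ T.cache n ω
    · simp [thinFactor, PicoTier.mark, hc, hnone n hc]
    · simp [thinFactor, PicoTier.mark, hc]
  · obtain ⟨n, hc, hn⟩ := PicoTier.not_noneWithin.1 hnone
    obtain ⟨S, hS⟩ := h.exists_finset (max Q.RL a)
    refine finprod_eq_zero _ n (by simp [thinFactor, PicoTier.mark, hc, hn])
      (S.finite_toSet.subset fun m hm => ?_)
    by_contra hmS
    exact hm (thinFactor_of_lt Q κ (hS m hmS) _)

lemma PicoTier.bddBelow_servingDist : BddBelow {v | ∃ n, f ∈ T.cache n ω ∧ v = ‖T.loc n ω‖} :=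
  ⟨0, by rintro v ⟨n, _, rfl⟩; exact norm_nonneg _⟩

lemma PicoTier.servingDist_le {n : ℕ} (hn : f ∈ T.cache n ω) :
    T.servingDist f ω ≤ ‖T.loc n ω‖ :=
  csInf_le bddBelow_servingDist ⟨n, hn, rfl⟩

lemma PicoTier.servingDist_of_forall_notMem (h : ∀ n, f ∉ T.cache n ω) :
    T.servingDist f ω = 0 := by
  simp [PicoTier.servingDist, h]

lemma PicoTier.servingDist_lt_iff {t : ℝ} : T.servingDist f ω < t ↔
    (∃ n, f ∈ T.cache n ω ∧ ‖T.loc n ω‖ < t) ∨ 0 < t ∧ ∀ n, f ∉ T.cache n ω := by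
  by_cases hex : ∃ n, f ∈ T.cache n ω
  · obtain ⟨n, hn⟩ := hex
    rw [PicoTier.servingDist, csInf_lt_iff bddBelow_servingDist ⟨_, n, hn, rfl⟩]
    have : ¬ ∀ n, f ∉ T.cache n ω := fun hall => hall n hn
    simp [this]
  · push Not at hex
    simp [PicoTier.servingDist_of_forall_notMem hex, hex]

lemma PicoTier.IsRegular.exists_norm_eq_servingDist (h : T.IsRegular ω) {n : ℕ}
    (hn : f ∈ T.cache n ω) : ∃ m, f ∈ T.cache m ω ∧ ‖T.loc m ω‖ = T.servingDist f ω := by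
  obtain ⟨k, hk⟩ := exists_nat_ge ‖T.loc n ω‖
  have hfin : {m | ‖T.loc m ω‖ ≤ k ∧ f ∈ T.cache m ω}.Finite := (h.1 k).subset fun m hm => hm.1
  obtain ⟨m, hm, hmin⟩ := Set.exists_min_image _ (fun m => ‖T.loc m ω‖) hfin ⟨n, hk, hn⟩
  refine ⟨m, hm.2, le_antisymm (le_csInf ⟨_, n, hn, rfl⟩ ?_) (PicoTier.servingDist_le hm.2)⟩
  rintro v ⟨j, hj, rfl⟩
  rcases le_or_gt ‖T.loc j ω‖ k with hjk | hjk
  · exact hmin j ⟨hjk, hj⟩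
  · exact hm.1.trans hjk.le

lemma PicoTier.IsRegular.servingDist_mem_Ioc_iff (h : T.IsRegular ω) {a b : ℝ} (ha : 0 ≤ a) :
    T.servingDist f ω ∈ Set.Ioc a b ↔ T.NoneWithin f a ω ∧ ¬ T.NoneWithin f b ω := by
  rw [PicoTier.not_noneWithin]
  constructor
  · rintro ⟨hlt, hle⟩
    have hex : ∃ n, f ∈ T.cache n ω := by
      by_contra! hex
      exact (ha.trans_lt hlt).ne' (PicoTier.servingDist_of_forall_notMem hex)
    obtain ⟨n, hn⟩ := hex
    obtain ⟨m, hm, hmD⟩ := h.exists_norm_eq_servingDist hn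
    exact ⟨fun n hn => hlt.trans_le (PicoTier.servingDist_le hn), m, hm, hmD.trans_le hle⟩
  · rintro ⟨hnone, n, hn, hnb⟩
    obtain ⟨m, hm, hmD⟩ := h.exists_norm_eq_servingDist hn
    exact ⟨hmD ▸ hnone m hm, (PicoTier.servingDist_le hn).trans hnb⟩

/-- The set of points at distance in `(a, b]` from the user. -/
def annulus (a b : ℝ) : Set Plane := {x | a < ‖x‖ ∧ ‖x‖ ≤ b}

-- The sums defining the two powers differ only at BSs of the annulus, of which there is just one.
lemma PicoTier.IsRegular.interference_eq_background (h : T.IsRegular ω) {a b : ℝ}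
    (ha : T.NoneWithin f a ω) (hb : ¬ T.NoneWithin f b ω)
    (hcard : ¬ 2 ≤ {n | T.loc n ω ∈ annulus a b}.encard) :
    T.interference Q f ω = T.background Q f b ω := by
  classical
  have hsub : {n | T.loc n ω ∈ annulus a b}.Subsingleton := by
    rw [← Set.encard_le_one_iff_subsingleton]
    exact Order.le_of_lt_add_one (by rwa [one_add_one_eq_two, ← not_le])
  obtain ⟨j, hj, hjb⟩ := PicoTier.not_noneWithin.1 hb
  obtain ⟨m, hm, hmD⟩ := h.exists_norm_eq_servingDist hj
  have hmb : ‖T.loc m ω‖ ≤ b := hmD.trans_le ((PicoTier.servingDist_le hj).trans hjb)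
  have hserving (n) : T.IsServing f n ω ↔ f ∈ T.cache n ω ∧ ‖T.loc n ω‖ ≤ b := by
    refine ⟨fun hn => ⟨hn.1, (hn.2 j hj).trans hjb⟩, fun hn => ?_⟩
    obtain rfl : n = m := hsub ⟨ha n hn.1, hn.2⟩ ⟨ha m hm, hmb⟩
    exact ⟨hm, fun i hi => hmD.trans_le (PicoTier.servingDist_le hi)⟩
  simp only [h.interference_eq, hserving, PicoTier.background]

end Pathwise

section Measurability

lemma ae_nonneg_gammaMeasure (a r : ℝ) : ∀ᵐ y ∂gammaMeasure a r, 0 ≤ y := by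
  refine (ae_withDensity_iff (measurable_gammaPDFReal a r).ennreal_ofReal).2
    (Eventually.of_forall fun y hy => ?_)
  contrapose! hy
  exact gammaPDF_of_neg hy

variable {Ω : Type*} [MeasurableSpace Ω] {μ : Measure Ω} {Nc : ℕ} {Q : Params Nc}
  {T : PicoTier Ω Nc}

lemma IsPicoTier.measurableSet_cache (hT : IsPicoTier μ Q T) (f : Fin Nc) (n : ℕ) :
    MeasurableSet {ω | f ∈ T.cache n ω} :=
  measurableSet_setOfPred.2 ((measurable_set_mem f).comp (hT.cache_measurable n))

lemma IsPicoTier.measurable_norm_loc (hT : IsPicoTier μ Q T) (n : ℕ) :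
    Measurable fun ω => ‖T.loc n ω‖ := (hT.hppp.measurable n).norm

lemma IsPicoTier.measurable_servingDist (hT : IsPicoTier μ Q T) (f : Fin Nc) :
    Measurable (T.servingDist f) := by
  refine measurable_of_Iio fun t => ?_
  have hset : T.servingDist f ⁻¹' Set.Iio t =
      (⋃ n, {ω | f ∈ T.cache n ω} ∩ {ω | ‖T.loc n ω‖ < t}) ∪
        ({_ω | 0 < t} ∩ ⋂ n, {ω | f ∈ T.cache n ω}ᶜ) := by
    ext ω
    simp [PicoTier.servingDist_lt_iff]
  rw [hset]
  exact (MeasurableSet.iUnion fun n => (hT.measurableSet_cache f n).inter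
    (measurableSet_lt (hT.measurable_norm_loc n) measurable_const)).union
    ((MeasurableSet.const _).inter
      (MeasurableSet.iInter fun n => (hT.measurableSet_cache f n).compl))

lemma IsPicoTier.measurableSet_noneWithin (hT : IsPicoTier μ Q T) (f : Fin Nc) (t : ℝ) :
    MeasurableSet {ω | T.NoneWithin f t ω} := by
  simp only [PicoTier.NoneWithin, Set.ofPred_forall]
  exact MeasurableSet.iInter fun n => (hT.measurableSet_cache f n).imp
    (measurableSet_lt measurable_const (hT.measurable_norm_loc n))

lemma IsPicoTier.measurableSet_isServing (hT : IsPicoTier μ Q T) (f : Fin Nc) (n : ℕ) :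
    MeasurableSet {ω | T.IsServing f n ω} := by
  simp only [PicoTier.IsServing, Set.ofPred_and, Set.ofPred_forall]
  exact (hT.measurableSet_cache f n).inter (MeasurableSet.iInter fun m =>
    (hT.measurableSet_cache f m).imp
      (measurableSet_le (hT.measurable_norm_loc n) (hT.measurable_norm_loc m)))

lemma IsPicoTier.measurable_interference (hT : IsPicoTier μ Q T) (f : Fin Nc) :
    Measurable (T.interference Q f) := by
  classical
  have := measurable_pathLoss Q
  have := (continuous_arrayGain Q.Nant_pos).measurable
  have := hT.measurable_norm_loc
  have := hT.fading_measurable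
  have := hT.angle_measurable
  exact Measurable.tsum fun n => Measurable.ite (hT.measurableSet_isServing f n) measurable_const
    (by fun_prop)

lemma IsPicoTier.measurable_background (hT : IsPicoTier μ Q T) (f : Fin Nc) (b : ℝ) :
    Measurable (T.background Q f b) := by
  classical
  have hrx (n : ℕ) : Measurable (T.rx Q n) :=
    (measurable_rxPower Q).comp (f := fun ω => (T.loc n ω, T.fading n ω, T.angle n ω))
      ((hT.hppp.measurable n).prodMk ((hT.fading_measurable n).prodMk (hT.angle_measurable n)))
  exact Measurable.tsum fun n => Measurable.ite ((hT.measurableSet_cache f n).inter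
    (measurableSet_le (hT.measurable_norm_loc n) measurable_const)) measurable_const (hrx n)

variable [IsProbabilityMeasure μ]

lemma IsPicoTier.ae_isRegular (hT : IsPicoTier μ Q T) : ∀ᵐ ω ∂μ, T.IsRegular ω := by
  have hfin (k : ℕ) : ∀ᵐ ω ∂μ, {n | ‖T.loc n ω‖ ≤ k}.Finite := by
    have := hT.hppp.ae_finite (A := Metric.closedBall 0 k) measurableSet_closedBall
      Metric.isBounded_closedBall
    simpa only [mem_closedBall_zero_iff] using this
  have hfading (n : ℕ) : ∀ᵐ ω ∂μ, 0 ≤ T.fading n ω :=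
    ae_of_ae_map (p := fun y => 0 ≤ y) (hT.fading_measurable n).aemeasurable
      ((hT.fading_law n).symm ▸ ae_nonneg_gammaMeasure _ _)
  filter_upwards [ae_all_iff.2 hfin, ae_all_iff.2 hfading] with ω hfin hfading
    using ⟨hfin, hfading⟩

end Measurability

section ConditionalExpectation

lemma eq_of_abs_sub_le_sq {s : Set ℝ} (hs : Convex ℝ s) {g : ℝ → ℝ} {C : ℝ}
    (h : ∀ x ∈ s, ∀ y ∈ s, x ≤ y → |g y - g x| ≤ C * (y - x) ^ 2) {x y : ℝ} (hx : x ∈ s)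
    (hy : y ∈ s) : g x = g y := by
  have hderiv (x) (hx : x ∈ s) : HasFDerivWithinAt g (0 : ℝ →L[ℝ] ℝ) s x := by
    have hO : (fun y => g y - g x) =O[𝓝[s] x] fun y => ‖y - x‖ ^ 2 := by
      refine .of_bound C (eventually_nhdsWithin_of_forall fun y hy => ?_)
      rw [norm_pow, norm_norm, Real.norm_eq_abs, Real.norm_eq_abs, sq_abs]
      rcases le_total x y with hxy | hyx
      · exact h x hx y hy hxy
      · rw [abs_sub_comm, ← neg_sub x y, neg_sq]
        exact h y hy x hx hyx
    simpa using (hO.hasFDerivWithinAt (𝕜 := ℝ) hx one_lt_two).add_const (g x)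
  have := hs.norm_image_sub_le_of_norm_hasFDerivWithin_le hderiv (fun _ _ => norm_zero.le) hx hy
  rw [zero_mul, norm_le_zero_iff, sub_eq_zero] at this
  exact this.symm

lemma ae_eq_of_setIntegral_Ioc_eq {ρ : Measure ℝ} [IsFiniteMeasure ρ] {g h : ℝ → ℝ}
    (hg : Measurable g) (hh : Measurable h) (hgi : Integrable g ρ) (hhi : Integrable h ρ)
    (hg0 : ∀ r, 0 ≤ g r) (hh0 : ∀ r, 0 ≤ h r) {a : ℝ}
    (heq : ∀ b, ∫ r in Set.Ioc a b, g r ∂ρ = ∫ r in Set.Ioc a b, h r ∂ρ) :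
    ∀ᵐ r ∂ρ, a < r → g r = h r := by
  have hinter (t : ℝ) : Set.Iic t ∩ Set.Ioi a = Set.Ioc a t := by
    rw [Set.inter_comm, Set.Ioi_inter_Iic]
  have hdens : (ρ.restrict (Set.Ioi a)).withDensity (fun r => ENNReal.ofReal (g r)) =
      (ρ.restrict (Set.Ioi a)).withDensity fun r => ENNReal.ofReal (h r) := by
    have := isFiniteMeasure_withDensity_ofReal (hgi.restrict (s := Set.Ioi a)).2
    refine Measure.ext_of_Iic _ _ fun t => ?_
    rw [withDensity_apply _ measurableSet_Iic, withDensity_apply _ measurableSet_Iic,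
      Measure.restrict_restrict measurableSet_Iic, hinter,
      ← ofReal_integral_eq_lintegral_ofReal hgi.restrict (ae_of_all _ hg0),
      ← ofReal_integral_eq_lintegral_ofReal hhi.restrict (ae_of_all _ hh0),
      heq t]
  rw [withDensity_eq_iff_of_sigmaFinite hg.ennreal_ofReal.aemeasurable
    hh.ennreal_ofReal.aemeasurable] at hdens
  filter_upwards [(ae_restrict_iff' measurableSet_Ioi).1 hdens] with r hr hra
  exact (ENNReal.ofReal_eq_ofReal_iff (hg0 r) (hh0 r)).1 (hr hra)

variable {Ω : Type*} [MeasurableSpace Ω] {μ : Measure Ω}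

lemma setIntegral_preimage_Ioc_eq_zero {D H : Ω → ℝ} (hD : Measurable D) (hH : Integrable H μ)
    {c R C : ℝ} (h : ∀ a b, c ≤ a → a ≤ b → b ≤ R →
      |∫ ω in D ⁻¹' Set.Ioc a b, H ω ∂μ| ≤ C * (b - a) ^ 2) :
    ∫ ω in D ⁻¹' Set.Ioc c R, H ω ∂μ = 0 := by
  rcases le_total R c with hRc | hcR
  · simp [Set.Ioc_eq_empty_of_le hRc]
  have hincr (x) (hx : x ∈ Set.Icc c R) (y) (hy : y ∈ Set.Icc c R) (hxy : x ≤ y) :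
      |∫ ω in D ⁻¹' Set.Ioc c y, H ω ∂μ - ∫ ω in D ⁻¹' Set.Ioc c x, H ω ∂μ| ≤
        C * (y - x) ^ 2 := by
    rw [← Set.Ioc_union_Ioc_eq_Ioc hx.1 hxy, Set.preimage_union, setIntegral_union
      ((Set.Ioc_disjoint_Ioc_of_le le_rfl).preimage D) (hD measurableSet_Ioc) hH.integrableOn
      hH.integrableOn, add_sub_cancel_left]
    exact h x y hx.1 hxy hy.2
  have hconst := eq_of_abs_sub_le_sq (convex_Icc c R) hincr (x := c) (y := R)
    (Set.left_mem_Icc.2 hcR) (Set.right_mem_Icc.2 hcR)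
  simpa using hconst.symm

lemma abs_setIntegral_sub_le_measureReal [IsFiniteMeasure μ] {X Y : Ω → ℝ} (hX : Integrable X μ)
    (hY : Integrable Y μ) (hX1 : ∀ᵐ ω ∂μ, X ω ∈ Set.Icc 0 1) (hY1 : ∀ᵐ ω ∂μ, Y ω ∈ Set.Icc 0 1)
    {E B : Set Ω} (hE : MeasurableSet E) (hB : MeasurableSet B)
    (heq : ∀ᵐ ω ∂μ, ω ∈ E → ω ∉ B → X ω = Y ω) :
    |∫ ω in E, X ω ∂μ - ∫ ω in E, Y ω ∂μ| ≤ μ.real B := by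
  have hBint : Integrable (B.indicator (1 : Ω → ℝ)) (μ.restrict E) :=
    (integrable_indicator_iff hB).2 (integrableOn_const (hs := measure_ne_top _ _))
  rw [← integral_sub hX.integrableOn hY.integrableOn, ← Real.norm_eq_abs]
  calc ‖∫ ω in E, (X ω - Y ω) ∂μ‖ ≤ ∫ ω in E, B.indicator 1 ω ∂μ := by
        refine norm_integral_le_of_norm_le hBint ((ae_restrict_iff' hE).2 ?_)
        filter_upwards [hX1, hY1, heq] with ω hX1 hY1 heq hωE
        by_cases hωB : ω ∈ B
        · rw [Set.indicator_of_mem hωB, Real.norm_eq_abs, Pi.one_apply, abs_le]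
          constructor <;> linarith [hX1.1, hX1.2, hY1.1, hY1.2]
        · simp [heq hωE hωB, Set.indicator_of_notMem hωB]
    _ = (μ.restrict E).real B := integral_indicator_one hB
    _ ≤ μ.real B := ENNReal.toReal_mono (measure_ne_top _ _) (Measure.restrict_apply_le _ _)

lemma abs_setIntegral_monotone_comp_sub_le [IsFiniteMeasure μ] {D : Ω → ℝ} {g : ℝ → ℝ}
    (hg : Monotone g) (hgi : Integrable (fun ω => g (D ω)) μ) (a b : ℝ) :
    |μ.real (D ⁻¹' Set.Ioc a b) * g b - ∫ ω in D ⁻¹' Set.Ioc a b, g (D ω) ∂μ| ≤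
      μ.real (D ⁻¹' Set.Ioc a b) * (g b - g a) := by
  have hbound (ω) (hω : ω ∈ D ⁻¹' Set.Ioc a b) : ‖g b - g (D ω)‖ ≤ g b - g a := by
    rw [Real.norm_of_nonneg (sub_nonneg.2 (hg hω.2))]
    exact sub_le_sub_left (hg hω.1.le) _
  rw [← smul_eq_mul, ← setIntegral_const,
    ← integral_sub (integrable_const (μ := μ.restrict _) (g b)) hgi.integrableOn, mul_comm]
  exact norm_setIntegral_le_of_norm_le_const (measure_lt_top μ _) hbound

variable [IsProbabilityMeasure μ] {D I : Ω → ℝ} {φ : ℝ → ℝ}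

lemma integrable_integral_condDistrib (hD : Measurable D) (hI : AEMeasurable I μ)
    (hφ : Measurable φ) (hint : Integrable (fun ω => φ (I ω)) μ) :
    Integrable (fun r => ∫ y, φ y ∂(condDistrib I D μ r)) (μ.map D) :=
  (integrable_map_measure (hφ.comp measurable_snd).aestronglyMeasurable
    (hD.aemeasurable.prodMk hI)).2 hint |>.integral_condDistrib_map hI

lemma setIntegral_integral_condDistrib (hD : Measurable D) (hI : AEMeasurable I μ)
    (hφ : Measurable φ) (hint : Integrable (fun ω => φ (I ω)) μ) {s : Set ℝ}
    (hs : MeasurableSet s) :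
    ∫ r in s, ∫ y, φ y ∂(condDistrib I D μ r) ∂(μ.map D) = ∫ ω in D ⁻¹' s, φ (I ω) ∂μ := by
  rw [setIntegral_map hs (integrable_integral_condDistrib hD hI hφ hint).aestronglyMeasurable
      hD.aemeasurable,
    ← setIntegral_condExp hD.comap_le hint ⟨s, hs, rfl⟩]
  exact integral_congr_ae (ae_restrict_of_ae
    (condExp_ae_eq_integral_condDistrib hD hI hφ.stronglyMeasurable hint).symm)

lemma ae_integral_condDistrib_eq (hD : Measurable D) (hI : AEMeasurable I μ) (hφ : Measurable φ)
    (hφ0 : ∀ y, 0 ≤ φ y) (hint : Integrable (fun ω => φ (I ω)) μ) {g : ℝ → ℝ} (hg : Measurable g)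
    (hg0 : ∀ r, 0 ≤ g r) (hgi : Integrable (fun ω => g (D ω)) μ) {a : ℝ}
    (h : ∀ b, ∫ ω in D ⁻¹' Set.Ioc a b, φ (I ω) ∂μ = ∫ ω in D ⁻¹' Set.Ioc a b, g (D ω) ∂μ) :
    ∀ᵐ r ∂(μ.map D), a < r → ∫ y, φ y ∂(condDistrib I D μ r) = g r := by
  have hL : Measurable fun r => ∫ y, φ y ∂(condDistrib I D μ r) :=
    (hφ.comp measurable_snd).stronglyMeasurable.integral_condDistrib.measurable
  refine ae_eq_of_setIntegral_Ioc_eq hL hg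
    (integrable_integral_condDistrib hD hI hφ hint)
    ((integrable_map_measure hg.aestronglyMeasurable hD.aemeasurable).2 hgi)
    (fun r => integral_nonneg hφ0) hg0 fun b => ?_
  rw [setIntegral_integral_condDistrib hD hI hφ hint measurableSet_Ioc, h b,
    setIntegral_map measurableSet_Ioc hg.aestronglyMeasurable hD.aemeasurable]

lemma ae_ae_condDistrib_nonneg (hD : Measurable D) (hI : AEMeasurable I μ)
    (h : ∀ᵐ ω ∂μ, 0 ≤ I ω) : ∀ᵐ r ∂(μ.map D), ∀ᵐ y ∂(condDistrib I D μ r), 0 ≤ y := by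
  refine Measure.ae_ae_of_ae_compProd (p := fun z : ℝ × ℝ => 0 ≤ z.2) ?_
  rwa [compProd_map_condDistrib hI, ae_map_iff (hD.aemeasurable.prodMk hI)
    (measurableSet_le measurable_const measurable_snd)]

-- The absolute value makes the Laplace transform continuous on the whole line.
lemma continuous_integral_exp_neg_abs_mul {ν : Measure ℝ} [IsFiniteMeasure ν]
    (hν : ∀ᵐ y ∂ν, 0 ≤ y) : Continuous fun κ : ℝ => ∫ y, Real.exp (-(|κ| * y)) ∂ν := by
  refine continuous_of_dominated (bound := fun _ => 1)
    (fun κ => Measurable.aestronglyMeasurable (by fun_prop)) (fun κ => ?_) (integrable_const _)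
    (ae_of_all _ fun y => by fun_prop)
  filter_upwards [hν] with y hy
  rw [Real.norm_of_nonneg (Real.exp_pos _).le]
  exact (exp_neg_mul_mem_Icc (abs_nonneg κ) hy).2

end ConditionalExpectation

section Exponent

variable {Nc : ℕ} (Q : Params Nc) (f : Fin Nc)

lemma measurableSet_annulus (a b : ℝ) : MeasurableSet (annulus a b) :=
  (measurableSet_lt measurable_const measurable_norm).inter
    (measurableSet_le measurable_norm measurable_const)

lemma isBounded_annulus (a b : ℝ) : Bornology.IsBounded (annulus a b) :=
  (Metric.isBounded_closedBall (x := (0 : Plane)) (r := b)).subset fun x hx => by simpa using hx.2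

lemma volume_real_annulus {a b : ℝ} (ha : 0 ≤ a) (hab : a ≤ b) :
    volume.real (annulus a b) = Real.pi * (b ^ 2 - a ^ 2) := by
  have hset : annulus a b = Metric.closedBall 0 b \ Metric.closedBall 0 a := by
    ext x
    simp [annulus, and_comm]
  rw [hset, measureReal_sdiff (Metric.closedBall_subset_closedBall hab) measurableSet_closedBall
    Metric.isBounded_closedBall.measure_lt_top.ne, volume_real_closedBall (ha.trans hab),
    volume_real_closedBall ha, mul_sub]

/-- Mean number of BSs in the annulus `annulus a b`. -/
def annulusMean (a b : ℝ) : ℝ := Q.lam * (Real.pi * (b ^ 2 - a ^ 2))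

lemma annulusMean_nonneg {a b : ℝ} (ha : 0 ≤ a) (hab : a ≤ b) : 0 ≤ annulusMean Q a b :=
  mul_nonneg Q.lam_pos.le (mul_nonneg Real.pi_pos.le (sub_nonneg.2 (by gcongr)))

lemma annulusMean_le {a b R : ℝ} (hab : a ≤ b) (hbR : b ≤ R) :
    annulusMean Q a b ≤ 2 * (Q.lam * Real.pi * R) * (b - a) := by
  have hlam := Q.lam_pos
  calc annulusMean Q a b = Q.lam * Real.pi * ((b + a) * (b - a)) := by rw [annulusMean]; ring
    _ ≤ Q.lam * Real.pi * (2 * R * (b - a)) := by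
      have := sub_nonneg.2 hab
      gcongr
      linarith
    _ = 2 * (Q.lam * Real.pi * R) * (b - a) := by ring

lemma exp_neg_sub_exp_neg_le {x y : ℝ} (hx : 0 ≤ x) (hxy : x ≤ y) :
    Real.exp (-x) - Real.exp (-y) ≤ y - x := by
  calc Real.exp (-x) - Real.exp (-y) = Real.exp (-x) * (1 - Real.exp (-(y - x))) := by
        rw [mul_sub, mul_one, ← Real.exp_add, ← neg_add, add_sub_cancel]
    _ ≤ 1 * (y - x) := by
        refine mul_le_mul (Real.exp_le_one_iff.2 (neg_nonpos.2 hx)) ?_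
          (sub_nonneg.2 (Real.exp_le_one_iff.2 (by linarith))) zero_le_one
        linarith [Real.one_sub_le_exp_neg (y - x)]
    _ = y - x := one_mul _

lemma antitone_backgroundProb (v : ℝ) : Antitone fun b => backgroundProb Q f b v := by
  intro a b hab
  have := Q.p_nonneg f
  simp only [backgroundProb]
  split_ifs <;> linarith

lemma backgroundProb_sub_le (a b : ℝ) (x : Plane) :
    backgroundProb Q f a ‖x‖ - backgroundProb Q f b ‖x‖ ≤ (annulus a b).indicator 1 x := by
  classical
  have := Q.p_nonneg f
  have := Q.p_le_one f
  simp only [backgroundProb, Set.indicator_apply, annulus, Set.mem_ofPred_eq, Pi.one_apply]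
  split_ifs <;> first | linarith | (exfalso; grind)

lemma interfExponent_nonneg {κ : ℝ} (hκ : 0 ≤ κ) (b : ℝ) : 0 ≤ interfExponent Q f κ b :=
  integral_nonneg fun x => mul_nonneg (backgroundProb_mem_Icc Q f b ‖x‖).1
    (sub_nonneg.2 (meanAttn_mem_Icc Q hκ x).2)

lemma antitone_interfExponent {κ : ℝ} (hκ : 0 ≤ κ) : Antitone (interfExponent Q f κ) :=
  fun a b hab => integral_mono (integrable_interfExponent Q f hκ b)
    (integrable_interfExponent Q f hκ a) fun x => mul_le_mul_of_nonneg_right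
      (antitone_backgroundProb Q f ‖x‖ hab) (sub_nonneg.2 (meanAttn_mem_Icc Q hκ x).2)

lemma interfExponent_sub_le {κ : ℝ} (hκ : 0 ≤ κ) {a b : ℝ} (ha : 0 ≤ a) (hab : a ≤ b) :
    interfExponent Q f κ a - interfExponent Q f κ b ≤ Real.pi * (b ^ 2 - a ^ 2) := by
  have hia := integrable_interfExponent Q f hκ a
  have hib := integrable_interfExponent Q f hκ b
  rw [← volume_real_annulus ha hab, ← integral_indicator_one (measurableSet_annulus a b),
    interfExponent, interfExponent, ← integral_sub hia hib]
  refine integral_mono (hia.sub hib) ((integrable_indicator_iff (measurableSet_annulus a b)).2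
    (integrableOn_const (hs := (isBounded_annulus a b).measure_lt_top.ne))) fun x => ?_
  rw [← sub_mul]
  exact (mul_le_of_le_one_right (sub_nonneg.2 (antitone_backgroundProb Q f ‖x‖ hab))
    (sub_le_self 1 (meanAttn_mem_Icc Q hκ x).1)).trans (backgroundProb_sub_le Q f a b x)

lemma interfExponent_zero (b : ℝ) : interfExponent Q f 0 b = 0 := by
  simp [interfExponent, meanAttn, attn]

lemma continuous_meanAttn_abs (x : Plane) : Continuous fun κ : ℝ => meanAttn Q |κ| x := by
  refine continuous_of_dominated (bound := fun _ => 1)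
    (fun κ => ((measurable_attn Q |κ|).comp measurable_prodMk_left).aestronglyMeasurable)
    (fun κ => ae_of_all _ fun z => ?_) (integrable_const _) (ae_of_all _ fun z => ?_)
  · obtain ⟨h0, h1⟩ := attn_mem_Icc Q (abs_nonneg κ) x z
    rwa [Real.norm_of_nonneg h0]
  · unfold attn
    fun_prop

lemma continuous_interfExponent_abs (b : ℝ) : Continuous fun κ => interfExponent Q f |κ| b :=
  continuous_of_dominated
    (fun κ => (integrable_interfExponent Q f (abs_nonneg κ) b).aestronglyMeasurable)
    (fun κ => ae_of_all _ (norm_interfExponent_integrand_le Q f (abs_nonneg κ) b))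
    (integrable_indicator_closedBall Q.RL)
    (ae_of_all _ fun x => continuous_const.mul (continuous_const.sub (continuous_meanAttn_abs Q x)))

/-- The Laplace transform, at `κ`, of the power received from the background of radius `b`; it is
also that of the interference given that the serving distance is `b`. -/
def condLaplace (κ b : ℝ) : ℝ := Real.exp (-(Q.lam * interfExponent Q f κ b))

lemma condLaplace_mem_Icc {κ : ℝ} (hκ : 0 ≤ κ) (b : ℝ) : condLaplace Q f κ b ∈ Set.Icc 0 1 :=
  exp_neg_mul_mem_Icc Q.lam_pos.le (interfExponent_nonneg Q f hκ b)

lemma monotone_condLaplace {κ : ℝ} (hκ : 0 ≤ κ) : Monotone (condLaplace Q f κ) :=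
  fun _ _ hab => Real.exp_le_exp.2 (neg_le_neg
    (mul_le_mul_of_nonneg_left (antitone_interfExponent Q f hκ hab) Q.lam_pos.le))

lemma condLaplace_zero (b : ℝ) : condLaplace Q f 0 b = 1 := by
  simp [condLaplace, interfExponent_zero]

lemma condLaplace_sub_le {κ : ℝ} (hκ : 0 ≤ κ) {a b : ℝ} (ha : 0 ≤ a) (hab : a ≤ b) :
    condLaplace Q f κ b - condLaplace Q f κ a ≤ annulusMean Q a b := by
  have hlam := Q.lam_pos.le
  refine (exp_neg_sub_exp_neg_le (mul_nonneg hlam (interfExponent_nonneg Q f hκ b))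
    (mul_le_mul_of_nonneg_left (antitone_interfExponent Q f hκ hab) hlam)).trans ?_
  rw [← mul_sub]
  exact mul_le_mul_of_nonneg_left (interfExponent_sub_le Q f hκ ha hab) hlam

lemma continuous_condLaplace_abs (b : ℝ) : Continuous fun κ => condLaplace Q f |κ| b :=
  Real.continuous_exp.comp ((continuous_interfExponent_abs Q f b).const_mul Q.lam).neg

end Exponent

section Serving

variable {Ω : Type*} [MeasurableSpace Ω] {μ : Measure Ω} [IsProbabilityMeasure μ] {Nc : ℕ}
  {Q : Params Nc} {T : PicoTier Ω Nc}

lemma IsPicoTier.integrable_exp_background (hT : IsPicoTier μ Q T) (f : Fin Nc) {κ : ℝ}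
    (hκ : 0 ≤ κ) (b : ℝ) : Integrable (fun ω => Real.exp (-(κ * T.background Q f b ω))) μ :=
  .of_mem_Icc 0 1 (Real.measurable_exp.comp
      ((hT.measurable_background f b).const_mul κ).neg).aemeasurable
    (ae_of_all _ fun _ => exp_neg_mul_mem_Icc hκ (PicoTier.background_nonneg b))

lemma IsPicoTier.ae_exp_interference_mem_Icc (hT : IsPicoTier μ Q T) (f : Fin Nc) {κ : ℝ}
    (hκ : 0 ≤ κ) : ∀ᵐ ω ∂μ, Real.exp (-(κ * T.interference Q f ω)) ∈ Set.Icc 0 1 :=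
  hT.ae_isRegular.mono fun _ hω => exp_neg_mul_mem_Icc hκ hω.interference_nonneg

lemma IsPicoTier.integrable_exp_interference (hT : IsPicoTier μ Q T) (f : Fin Nc) {κ : ℝ}
    (hκ : 0 ≤ κ) : Integrable (fun ω => Real.exp (-(κ * T.interference Q f ω))) μ :=
  .of_mem_Icc 0 1 (Real.measurable_exp.comp
      ((hT.measurable_interference f).const_mul κ).neg).aemeasurable
    (hT.ae_exp_interference_mem_Icc f hκ)

lemma IsPicoTier.integrable_condLaplace_servingDist (hT : IsPicoTier μ Q T) (f : Fin Nc) {κ : ℝ}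
    (hκ : 0 ≤ κ) : Integrable (fun ω => condLaplace Q f κ (T.servingDist f ω)) μ :=
  .of_mem_Icc 0 1 ((monotone_condLaplace Q f hκ).measurable.comp
      (hT.measurable_servingDist f)).aemeasurable
    (ae_of_all _ fun _ => condLaplace_mem_Icc Q f hκ _)

lemma IsPicoTier.setIntegral_noneWithin_exp_background (hT : IsPicoTier μ Q T) (f : Fin Nc)
    {κ a b : ℝ} (hκ : 0 ≤ κ) (ha : 0 ≤ a) (hab : a ≤ b) :
    ∫ ω in {ω | T.NoneWithin f a ω}, Real.exp (-(κ * T.background Q f b ω)) ∂μ =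
      Real.exp (-(Q.lam * (Q.p f * (Real.pi * a ^ 2)))) * condLaplace Q f κ b := by
  classical
  rw [condLaplace, ← Real.exp_add, ← neg_add, ← mul_add,
    ← hT.integral_finprod_thinFactor f hκ ha hab,
    ← integral_indicator (hT.measurableSet_noneWithin f a)]
  refine integral_congr_ae (hT.ae_isRegular.mono fun ω hω => ?_)
  exact (Set.indicator_apply _ _ ω).trans (hω.finprod_thinFactor κ a b).symm

lemma IsPicoTier.setIntegral_exp_background (hT : IsPicoTier μ Q T) (f : Fin Nc) {κ a b : ℝ}
    (hκ : 0 ≤ κ) (ha : 0 ≤ a) (hab : a ≤ b) :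
    ∫ ω in T.servingDist f ⁻¹' Set.Ioc a b, Real.exp (-(κ * T.background Q f b ω)) ∂μ =
      (Real.exp (-(Q.lam * (Q.p f * (Real.pi * a ^ 2)))) -
        Real.exp (-(Q.lam * (Q.p f * (Real.pi * b ^ 2))))) * condLaplace Q f κ b := by
  have hset : T.servingDist f ⁻¹' Set.Ioc a b =ᵐ[μ]
      ({ω | T.NoneWithin f a ω} \ {ω | T.NoneWithin f b ω} : Set Ω) :=
    hT.ae_isRegular.mono fun ω hω => propext (hω.servingDist_mem_Ioc_iff ha)
  have hsub : {ω | T.NoneWithin f b ω} ⊆ {ω | T.NoneWithin f a ω} :=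
    fun ω hω n hn => hab.trans_lt (hω n hn)
  rw [setIntegral_congr_set hset, setIntegral_sdiff (hT.measurableSet_noneWithin f b)
      (hT.integrable_exp_background f hκ b).integrableOn hsub,
    hT.setIntegral_noneWithin_exp_background f hκ ha hab,
    hT.setIntegral_noneWithin_exp_background f hκ (ha.trans hab) le_rfl, sub_mul]

lemma IsPicoTier.measureReal_servingDist (hT : IsPicoTier μ Q T) (f : Fin Nc) {a b : ℝ}
    (ha : 0 ≤ a) (hab : a ≤ b) :
    μ.real (T.servingDist f ⁻¹' Set.Ioc a b) =
      Real.exp (-(Q.lam * (Q.p f * (Real.pi * a ^ 2)))) -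
        Real.exp (-(Q.lam * (Q.p f * (Real.pi * b ^ 2)))) := by
  simpa [condLaplace_zero] using hT.setIntegral_exp_background f le_rfl ha hab

lemma IsPicoTier.measureReal_servingDist_le (hT : IsPicoTier μ Q T) (f : Fin Nc) {a b : ℝ}
    (ha : 0 ≤ a) (hab : a ≤ b) :
    μ.real (T.servingDist f ⁻¹' Set.Ioc a b) ≤ annulusMean Q a b := by
  have hlam := Q.lam_pos
  have hp := Q.p_nonneg f
  have hA := annulusMean_nonneg Q ha hab
  rw [hT.measureReal_servingDist f ha hab]
  calc _ ≤ Q.lam * (Q.p f * (Real.pi * b ^ 2)) - Q.lam * (Q.p f * (Real.pi * a ^ 2)) :=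
        exp_neg_sub_exp_neg_le (by positivity) (by gcongr)
    _ = Q.p f * annulusMean Q a b := by rw [annulusMean]; ring
    _ ≤ annulusMean Q a b := mul_le_of_le_one_left hA (Q.p_le_one f)

lemma IsPicoTier.ae_servingDist_pos (hT : IsPicoTier μ Q T) (f : Fin Nc) (hf : 0 < Q.p f) :
    ∀ᵐ r ∂(μ.map (T.servingDist f)), 0 < r := by
  have hD := hT.measurable_servingDist f
  rw [ae_map_iff hD.aemeasurable measurableSet_Ioi]
  have hbound (k : ℕ) : μ.real {ω | ¬ 0 < T.servingDist f ω} ≤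
      Real.exp (-(Q.lam * (Q.p f * (Real.pi * (k : ℝ) ^ 2)))) := by
    have hle : μ.real {ω | ¬ 0 < T.servingDist f ω} ≤
        μ.real (T.servingDist f ⁻¹' Set.Ioc 0 (k : ℝ))ᶜ :=
      measureReal_mono fun ω hω hmem => hω hmem.1
    rw [probReal_compl_eq_one_sub (hD measurableSet_Ioc),
      hT.measureReal_servingDist f le_rfl k.cast_nonneg] at hle
    simpa using hle
  have hlim : Tendsto (fun k : ℕ => Real.exp (-(Q.lam * (Q.p f * (Real.pi * (k : ℝ) ^ 2)))))
      atTop (𝓝 0) :=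
    Real.tendsto_exp_neg_atTop_nhds_zero.comp <| .const_mul_atTop Q.lam_pos <|
      .const_mul_atTop hf <| .const_mul_atTop Real.pi_pos <|
        (tendsto_pow_atTop two_ne_zero).comp tendsto_natCast_atTop_atTop
  exact (measureReal_eq_zero_iff).1 (le_antisymm (ge_of_tendsto' hlim hbound) measureReal_nonneg)

lemma IsPicoTier.abs_setIntegral_exp_interference_sub_background_le (hT : IsPicoTier μ Q T)
    (f : Fin Nc) {κ a b : ℝ} (hκ : 0 ≤ κ) (ha : 0 ≤ a) (hab : a ≤ b) :
    |∫ ω in T.servingDist f ⁻¹' Set.Ioc a b, Real.exp (-(κ * T.interference Q f ω)) ∂μ -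
      ∫ ω in T.servingDist f ⁻¹' Set.Ioc a b, Real.exp (-(κ * T.background Q f b ω)) ∂μ| ≤
      annulusMean Q a b ^ 2 := by
  have hmeas : MeasurableSet {ω | 2 ≤ {n | T.loc n ω ∈ annulus a b}.encard} :=
    hT.hppp.measurable_count (measurableSet_annulus a b) (.of_discrete (s := Set.Ici 2))
  rw [annulusMean, ← volume_real_annulus ha hab]
  refine (abs_setIntegral_sub_le_measureReal (hT.integrable_exp_interference f hκ)
    (hT.integrable_exp_background f hκ b) (hT.ae_exp_interference_mem_Icc f hκ)
    (ae_of_all _ fun _ => exp_neg_mul_mem_Icc hκ (PicoTier.background_nonneg b))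
    (hT.measurable_servingDist f measurableSet_Ioc) hmeas ?_).trans
    (hT.hppp.measureReal_two_le_count Q.lam_pos.le (measurableSet_annulus a b)
      (isBounded_annulus a b))
  filter_upwards [hT.ae_isRegular] with ω hω hmem hcard
  obtain ⟨hna, hnb⟩ := (hω.servingDist_mem_Ioc_iff ha).1 hmem
  rw [hω.interference_eq_background hna hnb hcard]

-- Both errors are of second order in the annulus: two BSs of the annulus, and a serving BS in the
-- annulus together with a variation of `condLaplace` over it.
lemma IsPicoTier.abs_setIntegral_exp_interference_sub_condLaplace_le (hT : IsPicoTier μ Q T)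
    (f : Fin Nc) {κ a b : ℝ} (hκ : 0 ≤ κ) (ha : 0 ≤ a) (hab : a ≤ b) :
    |∫ ω in T.servingDist f ⁻¹' Set.Ioc a b, Real.exp (-(κ * T.interference Q f ω)) ∂μ -
      ∫ ω in T.servingDist f ⁻¹' Set.Ioc a b, condLaplace Q f κ (T.servingDist f ω) ∂μ| ≤
      2 * annulusMean Q a b ^ 2 := by
  have hinterf := hT.abs_setIntegral_exp_interference_sub_background_le f hκ ha hab
  rw [hT.setIntegral_exp_background f hκ ha hab, ← hT.measureReal_servingDist f ha hab] at hinterf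
  have hmono := abs_setIntegral_monotone_comp_sub_le (monotone_condLaplace Q f hκ)
    (hT.integrable_condLaplace_servingDist f hκ) a b
  have hprod := mul_le_mul (hT.measureReal_servingDist_le f ha hab)
    (condLaplace_sub_le Q f hκ ha hab) (sub_nonneg.2 (monotone_condLaplace Q f hκ hab))
    (annulusMean_nonneg Q ha hab)
  refine (abs_sub_le _ _ _).trans ((add_le_add hinterf (hmono.trans hprod)).trans_eq ?_)
  ring

lemma IsPicoTier.setIntegral_exp_interference (hT : IsPicoTier μ Q T) (f : Fin Nc) {κ : ℝ}
    (hκ : 0 ≤ κ) (b : ℝ) :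
    ∫ ω in T.servingDist f ⁻¹' Set.Ioc 0 b, Real.exp (-(κ * T.interference Q f ω)) ∂μ =
      ∫ ω in T.servingDist f ⁻¹' Set.Ioc 0 b, condLaplace Q f κ (T.servingDist f ω) ∂μ := by
  have hX := hT.integrable_exp_interference f hκ
  have hL := hT.integrable_condLaplace_servingDist f hκ
  rw [← sub_eq_zero, ← integral_sub hX.integrableOn hL.integrableOn]
  refine setIntegral_preimage_Ioc_eq_zero (C := 8 * (Q.lam * Real.pi * b) ^ 2)
    (hT.measurable_servingDist f) (hX.sub hL) fun a c ha hac hcb => ?_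
  rw [integral_sub' hX.integrableOn hL.integrableOn]
  calc _ ≤ 2 * annulusMean Q a c ^ 2 :=
        hT.abs_setIntegral_exp_interference_sub_condLaplace_le f hκ ha hac
    _ ≤ 2 * (2 * (Q.lam * Real.pi * b) * (c - a)) ^ 2 := by
        have := annulusMean_nonneg Q ha hac
        gcongr
        exact annulusMean_le Q hac hcb
    _ = 8 * (Q.lam * Real.pi * b) ^ 2 * (c - a) ^ 2 := by ring

lemma IsPicoTier.ae_laplace_eq_rat (hT : IsPicoTier μ Q T) (f : Fin Nc) :
    ∀ᵐ r ∂(μ.map (T.servingDist f)), ∀ q : ℚ, 0 < r →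
      ∫ y, Real.exp (-(|(q : ℝ)| * y)) ∂(condDistrib (T.interference Q f) (T.servingDist f) μ r) =
        condLaplace Q f |(q : ℝ)| r := by
  refine ae_all_iff.2 fun q => ?_
  have hκ := abs_nonneg (q : ℝ)
  exact ae_integral_condDistrib_eq (hT.measurable_servingDist f)
    (hT.measurable_interference f).aemeasurable (by fun_prop) (fun y => (Real.exp_pos _).le)
    (hT.integrable_exp_interference f hκ) (monotone_condLaplace Q f hκ).measurable
    (fun r => (condLaplace_mem_Icc Q f hκ r).1) (hT.integrable_condLaplace_servingDist f hκ)
    (hT.setIntegral_exp_interference f hκ)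

lemma IsPicoTier.ae_laplace_eq (hT : IsPicoTier μ Q T) (f : Fin Nc) (hf : 0 < Q.p f) :
    ∀ᵐ r ∂(μ.map (T.servingDist f)), ∀ κ : ℝ, 0 ≤ κ →
      ∫ y, Real.exp (-(κ * y)) ∂(condDistrib (T.interference Q f) (T.servingDist f) μ r) =
        condLaplace Q f κ r := by
  have hnonneg := ae_ae_condDistrib_nonneg (hT.measurable_servingDist f)
    (hT.measurable_interference f).aemeasurable
    (hT.ae_isRegular.mono fun _ hω => hω.interference_nonneg (f := f) (Q := Q))
  filter_upwards [hT.ae_laplace_eq_rat f, hnonneg, hT.ae_servingDist_pos f hf]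
    with r hrat hnonneg hr κ hκ
  have hext := Continuous.ext_on (Rat.denseRange_cast (𝕜 := ℝ))
    (continuous_integral_exp_neg_abs_mul hnonneg) (continuous_condLaplace_abs Q f r)
    (Set.forall_mem_range.2 fun q => hrat q hr)
  simpa only [abs_of_nonneg hκ] using congrFun hext κ

end Serving

section AngleAverage

variable {α : ℝ} (N : ℕ) {x : ℝ → ℝ} {t : ℝ}

/-- The gamma Laplace transform `(1 + x v ^ (-α)) ^ (-N)` of the gain at distance `v`, averaged over
a normalised angle uniform on `[-1, 1]` on which `x` depends. -/
def angleAvg (α : ℝ) (N : ℕ) (x : ℝ → ℝ) (v : ℝ) : ℝ :=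
  1 / 2 * ∫ y in (-1 : ℝ)..1, ((1 + x y * v ^ (-α)) ^ N)⁻¹

lemma two_mul_mul_angleAvg (x : ℝ → ℝ) (v : ℝ) :
    2 * v * angleAvg α N x v =
      1 / 2 * ∫ y in (-1 : ℝ)..1, 2 * v * ((1 + x y * v ^ (-α)) ^ N)⁻¹ := by
  rw [angleAvg, intervalIntegral.integral_const_mul]
  ring

lemma integrable_radial_prod (hx : Measurable x) (hx0 : ∀ y, 0 ≤ x y) :
    Integrable (Function.uncurry fun v y => 2 * v * ((1 + x y * v ^ (-α)) ^ N)⁻¹)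
      ((volume.restrict (Set.Ioc 0 t)).prod (volume.restrict (Set.Ioc (-1 : ℝ) 1))) := by
  have hmeas : Measurable
      (Function.uncurry fun v y => 2 * v * ((1 + x y * v ^ (-α)) ^ N)⁻¹) := by
    simp only [Function.uncurry_def]
    fun_prop
  refine (integrable_const (2 * t)).mono' hmeas.aestronglyMeasurable ?_
  rw [Measure.prod_restrict]
  exact (ae_restrict_iff' (measurableSet_Ioc.prod measurableSet_Ioc)).2
    (ae_of_all _ fun z hz => norm_radial_integrand_le N (hx0 z.2) hz.1)

lemma intervalIntegrable_two_mul_angleAvg (hx : Measurable x) (hx0 : ∀ y, 0 ≤ x y) (ht : 0 ≤ t) :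
    IntervalIntegrable (fun v => 2 * v * angleAvg α N x v) volume 0 t := by
  rw [intervalIntegrable_iff_integrableOn_Ioc_of_le ht]
  simp only [two_mul_mul_angleAvg, intervalIntegral.integral_of_le (show (-1 : ℝ) ≤ 1 by norm_num)]
  exact (integrable_radial_prod N hx hx0).integral_prod_left.const_mul _

lemma integral_two_mul_angleAvg (hx : Measurable x) (hx0 : ∀ y, 0 ≤ x y) (ht : 0 ≤ t) :
    ∫ v in (0 : ℝ)..t, 2 * v * angleAvg α N x v =
      1 / 2 * ∫ y in (-1 : ℝ)..1, radialInt α N (x y) t := by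
  simp only [two_mul_mul_angleAvg]
  rw [intervalIntegral.integral_const_mul]
  simp only [radialInt, intervalIntegral.integral_of_le ht,
    intervalIntegral.integral_of_le (show (-1 : ℝ) ≤ 1 by norm_num)]
  rw [integral_integral_swap (integrable_radial_prod N hx hx0)]

lemma intervalIntegrable_two_mul_one_sub_angleAvg (hx : Measurable x) (hx0 : ∀ y, 0 ≤ x y)
    (ht : 0 ≤ t) :
    IntervalIntegrable (fun v => 2 * v * (1 - angleAvg α N x v)) volume 0 t := by
  simp only [mul_one_sub]
  exact (Continuous.intervalIntegrable (by fun_prop) _ _).sub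
    (intervalIntegrable_two_mul_angleAvg N hx hx0 ht)

lemma integral_two_mul_one_sub_angleAvg (hx : Measurable x) (hx0 : ∀ y, 0 ≤ x y) (ht : 0 ≤ t) :
    ∫ v in (0 : ℝ)..t, 2 * v * (1 - angleAvg α N x v) =
      t ^ 2 - 1 / 2 * ∫ y in (-1 : ℝ)..1, radialInt α N (x y) t := by
  simp only [mul_one_sub]
  rw [intervalIntegral.integral_sub (Continuous.intervalIntegrable (by fun_prop) _ _)
    (intervalIntegrable_two_mul_angleAvg N hx hx0 ht), integral_two_mul_angleAvg N hx hx0 ht,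
    intervalIntegral.integral_const_mul, integral_id]
  ring

end AngleAverage

section ClosedForm

lemma integral_exp_neg_mul_abs_gammaMeasure {N : ℕ} (hN : 0 < N) {t : ℝ} (ht : 0 ≤ t) :
    ∫ h, Real.exp (-(t * |h|)) ∂(gammaMeasure (N : ℝ) (N : ℝ)) = ((1 + t / N) ^ N)⁻¹ := by
  have hN' : (0 : ℝ) < N := by exact_mod_cast hN
  have := Real.Gamma_pos_of_pos hN'
  have hmeas : Measurable (gammaPDF (N : ℝ) N) := (measurable_gammaPDFReal _ _).ennreal_ofReal
  have hdensity (h : ℝ) : (gammaPDF (N : ℝ) N h).toReal • Real.exp (-(t * |h|)) =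
      (Set.Ici (0 : ℝ)).indicator (fun h => (N : ℝ) ^ (N : ℝ) / Real.Gamma N *
        (h ^ ((N : ℝ) - 1) * Real.exp (-((N + t) * h)))) h := by
    rw [gammaPDF, ENNReal.toReal_ofReal (gammaPDFReal_nonneg hN' hN' h), gammaPDFReal, smul_eq_mul]
    by_cases hh : 0 ≤ h
    · rw [if_pos hh, Set.indicator_of_mem (Set.mem_Ici.2 hh), abs_of_nonneg hh, add_mul, neg_add,
        Real.exp_add]
      ring
    · rw [if_neg hh, Set.indicator_of_notMem (by simpa using hh), zero_mul]
  rw [gammaMeasure, integral_withDensity_eq_integral_toReal_smul hmeas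
    (ae_of_all _ fun _ => ENNReal.ofReal_lt_top)]
  simp only [hdensity]
  rw [integral_indicator measurableSet_Ici, integral_Ici_eq_integral_Ioi, integral_const_mul,
    Real.integral_rpow_mul_exp_neg_mul_Ioi hN' (by positivity), Real.rpow_natCast,
    Real.rpow_natCast, show (1 : ℝ) + t / N = (N + t) / N by field_simp, div_pow, div_pow, one_pow]
  field_simp

lemma integral_fun_norm_plane (G : ℝ → ℝ) :
    ∫ x : Plane, G ‖x‖ = Real.pi * ∫ v in Set.Ioi (0 : ℝ), 2 * v * G v := by
  have hball : (volume : Measure Plane).real (Metric.ball 0 1) = Real.pi := by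
    rw [measureReal_def, EuclideanSpace.volume_ball_fin_two]
    simp [Real.pi_pos.le]
  rw [integral_fun_norm_addHaar volume G, hball, finrank_euclideanSpace_fin]
  simp only [mul_assoc, integral_const_mul, smul_eq_mul, nsmul_eq_mul, Nat.add_one_sub_one, pow_one,
    Nat.cast_ofNat]
  ring

variable {Nc : ℕ} (Q : Params Nc)

lemma integral_cond_uniform (φ : ℝ → ℝ) :
    ∫ w, φ w ∂(cond volume (Set.Icc (-(Q.d / Q.wl)) (Q.d / Q.wl))) =
      1 / 2 * ∫ y in (-1 : ℝ)..1, φ (y * Q.d / Q.wl) := by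
  have hd : 0 < Q.d / Q.wl := div_pos Q.d_pos Q.wl_pos
  have hscale : ∫ y in (-1 : ℝ)..1, φ (y * Q.d / Q.wl) =
      (Q.d / Q.wl)⁻¹ * ∫ w in (-(Q.d / Q.wl))..(Q.d / Q.wl), φ w := by
    have := intervalIntegral.integral_comp_mul_right (a := -1) (b := 1) φ hd.ne'
    simpa only [neg_mul, one_mul, smul_eq_mul, mul_div_assoc] using this
  rw [ProbabilityTheory.cond, integral_smul_measure, Real.volume_Icc, integral_Icc_eq_integral_Ioc,
    hscale, intervalIntegral.integral_of_le (by linarith), ENNReal.toReal_inv,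
    ENNReal.toReal_ofReal (by linarith), smul_eq_mul]
  field_simp
  ring

variable {s τ : ℝ}

lemma attn_eq_exp {x : Plane} (hx : ‖x‖ ≤ Q.RL) (h w : ℝ) :
    attn Q (s * τ / (Q.P * Q.C * Q.Nant)) x (h, w) =
      Real.exp (-(s * τ * arrayGain Q.Nant w * ‖x‖ ^ (-Q.α) * |h|)) := by
  have hA : (0 : ℝ) < Q.Nant := by exact_mod_cast Q.Nant_pos
  have hP := Q.P_pos
  have hC := Q.C_pos
  rw [attn, rxPower, pathLoss, if_pos (sub_nonneg.2 hx)]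
  congr 2
  field_simp

lemma meanAttn_eq_angleAvg (hs : 0 ≤ s) (hτ : 0 ≤ τ) {x : Plane} (hx : ‖x‖ ≤ Q.RL) :
    meanAttn Q (s * τ / (Q.P * Q.C * Q.Nant)) x =
      angleAvg Q.α Q.Nnak (fun y => argX Q (y * Q.d / Q.wl) s τ) ‖x‖ := by
  have hP := Q.P_pos
  have hC := Q.C_pos
  have hκ : 0 ≤ s * τ / (Q.P * Q.C * Q.Nant) := by positivity
  have hint : Integrable (attn Q (s * τ / (Q.P * Q.C * Q.Nant)) x) (channelLaw Q) :=
    .of_mem_Icc 0 1 ((measurable_attn Q _).comp measurable_prodMk_left).aemeasurable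
      (ae_of_all _ (attn_mem_Icc Q hκ x))
  rw [channelLaw] at hint
  rw [meanAttn, channelLaw, integral_prod_symm _ hint, angleAvg, ← integral_cond_uniform Q fun w =>
    ((1 + argX Q w s τ * ‖x‖ ^ (-Q.α)) ^ Q.Nnak)⁻¹]
  refine integral_congr_ae (ae_of_all _ fun w => ?_)
  have hG := arrayGain_nonneg Q.Nant w
  simp only [attn_eq_exp Q hx, argX]
  rw [integral_exp_neg_mul_abs_gammaMeasure Q.Nnak_pos (by positivity)]
  congr 3
  ring

lemma integral_Ioi_backgroundProb_mul (f : Fin Nc) {g : ℝ → ℝ} {b : ℝ} (hb : 0 ≤ b)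
    (hbR : b ≤ Q.RL) (hg : IntervalIntegrable g volume 0 Q.RL) :
    ∫ v in Set.Ioi (0 : ℝ), backgroundProb Q f b v * (Set.Iic Q.RL).indicator g v =
      (∫ v in (0 : ℝ)..Q.RL, g v) - Q.p f * ∫ v in (0 : ℝ)..b, g v := by
  have hsplit : ∀ v ∈ Set.Ioi (0 : ℝ), backgroundProb Q f b v * (Set.Iic Q.RL).indicator g v =
      (Set.Ioc 0 Q.RL).indicator g v - Q.p f * (Set.Ioc 0 b).indicator g v := by
    intro v hv
    simp only [backgroundProb, Set.indicator_apply, Set.mem_Iic, Set.mem_Ioc, Set.mem_Ioi.1 hv,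
      true_and]
    by_cases hvb : v ≤ b
    · simp only [hvb, hvb.trans hbR, if_true]
      ring
    · simp only [hvb, if_false, one_mul, mul_zero, sub_zero]
  have hgR := (intervalIntegrable_iff_integrableOn_Ioc_of_le Q.RL_pos.le).1 hg
  have hgb := hgR.mono_set (Set.Ioc_subset_Ioc_right hbR)
  have hinter (t : ℝ) : Set.Ioi (0 : ℝ) ∩ Set.Ioc 0 t = Set.Ioc 0 t :=
    Set.inter_eq_right.2 Set.Ioc_subset_Ioi_self
  rw [setIntegral_congr_fun measurableSet_Ioi hsplit,
    integral_sub ((integrable_indicator_iff measurableSet_Ioc).2 hgR).integrableOn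
      (((integrable_indicator_iff measurableSet_Ioc).2 hgb).integrableOn.const_mul _),
    integral_const_mul, setIntegral_indicator measurableSet_Ioc,
    setIntegral_indicator measurableSet_Ioc, hinter, hinter,
    intervalIntegral.integral_of_le Q.RL_pos.le, intervalIntegral.integral_of_le hb]

lemma interfExponent_eq_sub (f : Fin Nc) (hs : 0 ≤ s) (hτ : 0 ≤ τ) {b : ℝ} (hb : 0 ≤ b)
    (hbR : b ≤ Q.RL) :
    let avg := angleAvg Q.α Q.Nnak fun y => argX Q (y * Q.d / Q.wl) s τ
    interfExponent Q f (s * τ / (Q.P * Q.C * Q.Nant)) b =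
      Real.pi * ((∫ v in (0 : ℝ)..Q.RL, 2 * v * (1 - avg v)) -
        Q.p f * ∫ v in (0 : ℝ)..b, 2 * v * (1 - avg v)) := by
  intro avg
  have hX : Measurable fun y : ℝ => argX Q (y * Q.d / Q.wl) s τ :=
    ((continuous_argX Q s τ).comp (by fun_prop)).measurable
  have hradial (x : Plane) :
      backgroundProb Q f b ‖x‖ * (1 - meanAttn Q (s * τ / (Q.P * Q.C * Q.Nant)) x) =
        backgroundProb Q f b ‖x‖ * (Set.Iic Q.RL).indicator (fun v => 1 - avg v) ‖x‖ := by
    by_cases hx : ‖x‖ ≤ Q.RL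
    · rw [Set.indicator_of_mem (Set.mem_Iic.2 hx), meanAttn_eq_angleAvg Q hs hτ hx]
    · rw [Set.indicator_of_notMem (by simpa using hx), meanAttn_of_lt Q _ (not_le.1 hx), sub_self]
  simp only [interfExponent, hradial]
  rw [integral_fun_norm_plane fun v => backgroundProb Q f b v *
    (Set.Iic Q.RL).indicator (fun v => 1 - avg v) v, ← integral_Ioi_backgroundProb_mul Q f hb hbR
    (intervalIntegrable_two_mul_one_sub_angleAvg Q.Nnak hX (fun _ => argX_nonneg Q _ hs hτ)
      Q.RL_pos.le)]
  congr 2 with v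
  rw [Set.indicator_mul_right, mul_left_comm]

lemma interfExponent_eq_radialInt (f : Fin Nc) (hs : 0 ≤ s) (hτ : 0 ≤ τ) {b : ℝ} (hb : 0 ≤ b)
    (hbR : b ≤ Q.RL) :
    interfExponent Q f (s * τ / (Q.P * Q.C * Q.Nant)) b =
      Real.pi * (Q.RL ^ 2 - Q.p f * b ^ 2) + Real.pi / 2 * ∫ y in (-1 : ℝ)..1,
        (Q.p f * radialInt Q.α Q.Nnak (argX Q (y * Q.d / Q.wl) s τ) b -
          radialInt Q.α Q.Nnak (argX Q (y * Q.d / Q.wl) s τ) Q.RL) := by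
  have hX : Continuous fun y : ℝ => argX Q (y * Q.d / Q.wl) s τ :=
    (continuous_argX Q s τ).comp (by fun_prop)
  have hX0 (y : ℝ) : 0 ≤ argX Q (y * Q.d / Q.wl) s τ := argX_nonneg Q _ hs hτ
  rw [interfExponent_eq_sub Q f hs hτ hb hbR,
    integral_two_mul_one_sub_angleAvg Q.Nnak hX.measurable hX0 Q.RL_pos.le,
    integral_two_mul_one_sub_angleAvg Q.Nnak hX.measurable hX0 hb,
    intervalIntegral.integral_sub
      (((continuous_radialInt_comp Q.Nnak hX hX0 hb).intervalIntegrable _ _).const_mul _)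
      ((continuous_radialInt_comp Q.Nnak hX hX0 Q.RL_pos.le).intervalIntegrable _ _),
    intervalIntegral.integral_const_mul]
  ring

lemma IsPicoTier.tendsto_closedForm_laplace {Ω : Type*} [MeasurableSpace Ω] {μ : Measure Ω}
    [IsProbabilityMeasure μ] {Q : Params Nc} {T : PicoTier Ω Nc} (hT : IsPicoTier μ Q T)
    (f : Fin Nc) (hf : 0 < Q.p f) {W : ℝ → ℝ → ℝ → ℝ → ℝ}
    (hW : ∀ r, 0 < r → ∀ s τ, 0 ≤ s → 0 ≤ τ → ∀ w, W r w s τ =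
      Q.p f * radialInt Q.α Q.Nnak (argX Q w s τ) r -
        radialInt Q.α Q.Nnak (argX Q w s τ) Q.RL) :
    ∀ᵐ r ∂(μ.map (T.servingDist f)), r ≤ Q.RL → ∀ s τ : ℝ, 0 ≤ s → 0 ≤ τ →
      Tendsto (fun u : ℕ => closedForm Q f r (fun w => W r w s τ) u) atTop
        (𝓝 (laplaceInterference μ Q T f r s τ)) := by
  filter_upwards [hT.ae_laplace_eq f hf, hT.ae_servingDist_pos f hf]
    with r hlaplace hr hrR s τ hs hτ
  have hP := Q.P_pos
  have hC := Q.C_pos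
  have hX := continuous_argX Q s τ
  have hX0 (w : ℝ) : 0 ≤ argX Q w s τ := argX_nonneg Q w hs hτ
  have hWcont : Continuous fun w => W r w s τ := by
    simp only [hW r hr s τ hs hτ]
    exact ((continuous_radialInt_comp Q.Nnak hX hX0 hr.le).const_mul _).sub
      (continuous_radialInt_comp Q.Nnak hX hX0 Q.RL_pos.le)
  convert tendsto_closedForm Q f r hWcont using 2
  simp only [laplaceInterference, neg_mul, hW r hr s τ hs hτ]
  rw [hlaplace _ (by positivity), condLaplace, interfExponent_eq_radialInt Q f hs hτ hr.le hrR]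
  congr 1
  ring

end ClosedForm

end HetNet

end

theorem lemma1 {Ω : Type*} [MeasurableSpace Ω] (μ : Measure Ω) [IsProbabilityMeasure μ]
    {Nc : ℕ} (Q : HetNet.Params Nc) (T : HetNet.PicoTier Ω Nc) (hT : HetNet.IsPicoTier μ Q T)
    (f : Fin Nc) (hf : 0 < Q.p f) :
    (2 < Q.α → ∀ᵐ r ∂(μ.map (T.servingDist f)), r ≤ Q.RL →
      ∀ s τ : ℝ, 0 ≤ s → 0 ≤ τ →
        Tendsto (fun u : ℕ => HetNet.closedForm Q f r (fun w => HetNet.Wgt Q f r w s τ) u) atTop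
          (𝓝 (HetNet.laplaceInterference μ Q T f r s τ))) ∧
    (Q.α = 2 → ∀ᵐ r ∂(μ.map (T.servingDist f)), r ≤ Q.RL →
      ∀ s τ : ℝ, 0 ≤ s → 0 ≤ τ →
        Tendsto (fun u : ℕ => HetNet.closedForm Q f r (fun w => HetNet.Weq Q f r w s τ) u) atTop
          (𝓝 (HetNet.laplaceInterference μ Q T f r s τ))) := by
  exact ⟨fun hα => hT.tendsto_closedForm_laplace f hf fun _ hr _ _ hs hτ w =>
      HetNet.Wgt_eq_radialInt Q f hα hr w hs hτ,
    fun hα => hT.tendsto_closedForm_laplace f hf fun _ hr _ _ hs hτ w =>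
      HetNet.Weq_eq_radialInt Q f hα hr w hs hτ⟩
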